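/- Let $\Psi(r)$ be the maximum number of cycles (a cycle being a subgraph) among all finite connected simple graphs $G=(V,E)$ with cyclomatic number $r(G)=|E|-|V|+1$ equal to $r$. For $k\ge 3$ let $MC_k$ be the simple graph with the $2k$ vertices $x_1,\dots,x_k,y_1,\dots,y_k$ (indices taken modulo $k$) and with the following edges: $x_ix_{i+1}$ and $y_iy_{i+1}$ for $1\le i\le k$; the rungs $x_{2i-1}y_{2i}$ and $x_{2i}y_{2i-1}$ for $1\le i\le\lfloor k/2\rfloor$; and, if $k$ is odd, also the rung $x_ky_k$. Theorem. (i) For every $k\ge 3$, the graph $MC_k$ is connected and has cyclomatic number $k+1$, and the number of cycles in $MC_k$ is $$2^k+\left(k+\tfrac12\right)2^{k/2}-\tfrac32k\ \text{ if } k \text{ is even},\qquad 2^k+\left(k+\tfrac72\right)2^{(k-1)/2}-\tfrac12(3k+5)\ \text{ if } k \text{ is odd}.$$ (ii) For every $r\ge 4$, the maximum $\Psi(r)$ exists, and $$\Psi(r)\ge 2^{r-1}+\left(r-\tfrac12\right)2^{(r-1)/2}-\tfrac32(r-1)\ \text{ if } r \text{ is odd},$$ $$\Psi(r)\ge 2^{r-1}+\left(r+\tfrac52\right)2^{(r-2)/2}-\tfrac12(3r+2)\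 \text{ if } r \text{ is even}.$$ (iii) Consequently, there is a constant $c>0$ such that $\Psi(r)\ge 2^{r-1}+c\,r\,2^{r/2}$ for all sufficiently large $r$. -/

import Mathlib

open Filter

/-- The cycles of a graph, as subgraphs: a subgraph is a cycle if it is traced out by a closed walk
of positive length that repeats no edge and no vertex other than its endpoint. Walks that differ
only in starting point or direction trace out the same subgraph. -/
def cyclesOf {V : Type*} (G : SimpleGraph V) : Set G.Subgraph :=
  {H | ∃ (v : V) (p : G.Walk v v), p.IsCycle ∧ p.toSubgraph = H}

/-- The number of cycles of a (finite) graph. -/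
noncomputable def cycleCount {V : Type*} (G : SimpleGraph V) : ℕ :=
  (cyclesOf G).ncard

/-- The cyclomatic number `|E| - |V| + 1` of a (finite, connected) graph. -/
noncomputable def cyclomaticNumber {V : Type*} (G : SimpleGraph V) : ℤ :=
  (G.edgeSet.ncard : ℤ) - (Nat.card V : ℤ) + 1

/-- The set of all numbers of cycles of finite connected graphs with cyclomatic number `r`. -/
def cycleCounts (r : ℕ) : Set ℕ :=
  {c | ∃ (V : Type) (_ : Finite V) (G : SimpleGraph V),
    G.Connected ∧ cyclomaticNumber G = (r : ℤ) ∧ cycleCount G = c}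

/-- `Psi r` is the maximum number of cycles among all finite connected graphs with cyclomatic
number `r`. -/
noncomputable def Psi (r : ℕ) : ℕ := sSup (cycleCounts r)

/-- The edges of the two `k`-cycles: `x_i x_{i+1}` and `y_i y_{i+1}`, with indices modulo `k`.
The vertex `x_i` is `Sum.inl i` and the vertex `y_i` is `Sum.inr i`. -/
def railEdges (k : ℕ) : Set (Sym2 (ZMod k ⊕ ZMod k)) :=
  {e | ∃ i : ZMod k, e = s(Sum.inl i, Sum.inl (i + 1)) ∨ e = s(Sum.inr i, Sum.inr (i + 1))}

/-- The crossing rungs `x_{2i-1} y_{2i}` and `x_{2i} y_{2i-1}` for `1 ≤ i ≤ ⌊k/2⌋`. -/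
def crossingRungs (k : ℕ) : Set (Sym2 (ZMod k ⊕ ZMod k)) :=
  {e | ∃ i ∈ Finset.Icc 1 (k / 2),
    e = s(Sum.inl (2 * (i : ZMod k) - 1), Sum.inr (2 * (i : ZMod k))) ∨
    e = s(Sum.inl (2 * (i : ZMod k)), Sum.inr (2 * (i : ZMod k) - 1))}

/-- The straight rung `x_k y_k`, which is present only for odd `k`. -/
def straightRung (k : ℕ) : Set (Sym2 (ZMod k ⊕ ZMod k)) :=
  {e | Odd k ∧ e = s(Sum.inl (k : ZMod k), Sum.inr (k : ZMod k))}

/-- The crossed-rung prism graph `MC_k` (for `k ≥ 3`). -/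
def MC (k : ℕ) : SimpleGraph (ZMod k ⊕ ZMod k) :=
  SimpleGraph.fromEdgeSet (railEdges k ∪ crossingRungs k ∪ straightRung k)

/-! A cycle is the same as an edge-minimal nonempty subgraph with even degrees
(`cycleCount_eq_ncard_minimal`). Even subgraphs are determined by their edges off a spanning tree,
so there are at most `2 ^ r` cycles, and the maximum `Psi r` exists once a graph is exhibited. The
bounds come from `MC (r - 1)`, which is cubic and so has cyclomatic number `r`.

To count the cycles of `MC k`, group the columns in pairs. The two crossing rungs and two rail edges
of a pair form a 4-cycle that joins each left vertex (port) to each right vertex: a block. So `MC k`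
is a ring of `n` nodes, consecutive ones joined by two links; all nodes are blocks, except that odd
`k` leaves one column, a single rung. An even subgraph meets each pair of consecutive links with the
same parity. Given the links, a block has two complementary fillings and the column has one, which
gives the encoding `RingConfig`.

The minimal configurations (`isMinimalConfig_iff`) are of four kinds. With `b` blocks: - One link in
each gap, any filling: always a cycle; `2 ^ (n + b)`, which equals `2 ^ k`. - Both links in every
gap: each block passes the two strands straight or crossed, and they form one cycle iff the number
of crossings is odd; `2 ^ (b - 1)`. - No links: a single block; `b`. - Both links exactly on a
proper arc of gaps, with free fillings at the nodes it touches: a power of 2 for each arc. Summed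
over all arcs, these give the term of order `k * 2 ^ (k / 2)`. -/

/-! ### Cycles as minimal nonempty even subgraphs. -/

/-- All vertices have even degree. -/
def EvenDegrees {V : Type*} (H : SimpleGraph V) : Prop :=
  ∀ v, Even (H.neighborSet v).ncard

/-- A nonempty graph with even degrees, seen as a set of edges. -/
def IsNonzeroEven {V : Type*} (H : SimpleGraph V) : Prop :=
  H ≠ ⊥ ∧ EvenDegrees H

/-- Degrees add modulo 2 under symmetric difference. -/
theorem evenDegrees_symmDiff {V : Type*} [Finite V] {H K : SimpleGraph V}
    (hH : EvenDegrees H) (hK : EvenDegrees K) : EvenDegrees (symmDiff H K) := by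
  intro v
  have h : (symmDiff H K).neighborSet v =
      symmDiff (H.neighborSet v) (K.neighborSet v) := by
    ext w
    simp [symmDiff]
  have h1 := Set.ncard_sdiff_add_ncard (H.neighborSet v) (K.neighborSet v)
  have h2 := Set.ncard_union_add_ncard_inter (H.neighborSet v) (K.neighborSet v)
  have h3 := Set.ncard_sdiff_add_ncard (K.neighborSet v) (H.neighborSet v)
  have h4 : (symmDiff (H.neighborSet v) (K.neighborSet v)).ncard =
      (H.neighborSet v \ K.neighborSet v).ncard + (K.neighborSet v \ H.neighborSet v).ncard := by
    rw [Set.symmDiff_def]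
    exact Set.ncard_union_eq (by
      rw [Set.disjoint_left]; rintro a ⟨ha, hb⟩ ⟨hc, hd⟩; exact hb hc)
  rw [h, h4]
  rw [Set.union_comm] at h3
  have e1 := hH v
  have e2 := hK v
  rw [Nat.even_iff] at *
  omega

/-- A forest in which all degrees are even has no edges. -/
theorem EvenDegrees.eq_bot_of_isAcyclic {V : Type*} [Finite V] {H : SimpleGraph V}
    (hH : EvenDegrees H) (ha : H.IsAcyclic) : H = ⊥ := by
  classical
  have := Fintype.ofFinite V
  by_contra hne
  obtain ⟨u, v, huv⟩ := SimpleGraph.ne_bot_iff_exists_adj.mp hne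
  -- The component of an edge is a nontrivial tree; it has a leaf, whose degree 1 is odd.
  set c := H.connectedComponentMk u with hc
  have ht := ha.isTree_connectedComponent c
  have hu : u ∈ c.supp := rfl
  have hv : v ∈ c.supp := SimpleGraph.ConnectedComponent.sound huv.symm.reachable
  have : Nontrivial c := ⟨⟨⟨u, hu⟩, ⟨v, hv⟩, fun h => huv.ne (congrArg Subtype.val h)⟩⟩
  obtain ⟨w, hw⟩ := ht.exists_vert_degree_one_of_nontrivial
  have hcard : (H.neighborSet w.1).ncard = 1 := by
    rw [← hw, ← SimpleGraph.card_neighborFinset_eq_degree, ← Set.ncard_coe_finset,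
      SimpleGraph.coe_neighborFinset]
    rw [← Set.ncard_image_of_injective _ Subtype.val_injective]
    congr 1
    ext z
    simp only [SimpleGraph.mem_neighborSet, Set.mem_image, Subtype.exists]
    constructor
    · intro hz
      refine ⟨z, ?_, hz, rfl⟩
      exact (c.mem_supp_congr_adj hz).mp w.2
    · rintro ⟨z', hz', h, rfl⟩
      exact h
  have := hH w.1
  rw [hcard] at this
  exact absurd this (by decide)

/-- A nonempty even `K` inside the cycle `p` is not a forest, so it contains a cycle `q`. Both have
degree 2 at each vertex of `q`, hence `q` is closed under adjacency in `p` and is all of `p` by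
connectedness. -/
theorem cyclesOf_minimal {V : Type*} [Finite V] {G : SimpleGraph V} {H : G.Subgraph}
    (hH : H ∈ cyclesOf G) : Minimal IsNonzeroEven H.spanningCoe := by
  obtain ⟨u, p, hp, rfl⟩ := hH
  have hc := hp.isCycles_spanningCoe_toSubgraph
  have heven : ∀ {K : SimpleGraph V}, K.IsCycles → EvenDegrees K := by
    intro K hK v
    rcases (K.neighborSet v).eq_empty_or_nonempty with h | h
    · simp [h]
    · simp [hK h]
  refine ⟨⟨?_, heven hc⟩, ?_⟩
  · intro h
    have := p.toSubgraph_adj_snd (SimpleGraph.Walk.not_nil_iff_lt_length.mpr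
      (by have := hp.three_le_length; omega))
    rw [← SimpleGraph.Subgraph.spanningCoe_adj, h] at this
    exact this
  · intro K hK hle
    have hKa : ¬ K.IsAcyclic := fun h => hK.1 (hK.2.eq_bot_of_isAcyclic h)
    simp only [SimpleGraph.IsAcyclic, not_forall, not_not] at hKa
    obtain ⟨w, q, hq⟩ := hKa
    have hqle : q.toSubgraph.spanningCoe ≤ K := SimpleGraph.Subgraph.spanningCoe_le _
    have hcl := hq.isCycles_spanningCoe_toSubgraph
    have hKG : K ≤ G := hle.trans (SimpleGraph.Subgraph.spanningCoe_le _)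
    -- every neighbour along `p` of a vertex of `q` is a neighbour along `q`
    have key : ∀ a b, a ∈ q.toSubgraph.verts → p.toSubgraph.Adj a b → q.toSubgraph.Adj a b := by
      intro a b ha hab
      have h2 := hq.ncard_neighborSet_toSubgraph_eq_two (by simpa using ha)
      have h3 : (p.toSubgraph.spanningCoe.neighborSet a).ncard = 2 := hc ⟨b, hab⟩
      have hsub : q.toSubgraph.neighborSet a ⊆ p.toSubgraph.spanningCoe.neighborSet a := by
        intro z hz
        exact hle (hqle hz)
      have := Set.eq_of_subset_of_ncard_le hsub (by omega) (Set.toFinite _)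
      have hb : b ∈ p.toSubgraph.spanningCoe.neighborSet a := hab
      rw [← this] at hb
      exact hb
    have hreach : ∀ a b, p.toSubgraph.spanningCoe.Reachable a b →
        a ∈ q.toSubgraph.verts → b ∈ q.toSubgraph.verts := by
      rintro a b ⟨r⟩
      induction r with
      | nil => exact id
      | cons h _ ih => exact fun ha => ih (q.toSubgraph.edge_vert (key _ _ ha h).symm)
    have hw : w ∈ p.toSubgraph.verts := by
      have := q.toSubgraph_adj_snd (SimpleGraph.Walk.not_nil_iff_lt_length.mpr
        (by have := hq.three_le_length; omega))
      exact p.toSubgraph.edge_vert (hle (hqle this))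
    intro a b hab
    refine hqle (key a b ?_ hab)
    have hconn : p.toSubgraph.Connected := p.toSubgraph_connected
    have ha : a ∈ p.toSubgraph.verts := p.toSubgraph.edge_vert hab
    have hr := hconn.coe.preconnected ⟨w, hw⟩ ⟨a, ha⟩
    refine hreach w a ?_ (by simp)
    exact hr.map (⟨Subtype.val, fun h => h⟩ : p.toSubgraph.coe →g p.toSubgraph.spanningCoe)

theorem exists_mem_cyclesOf_of_minimal {V : Type*} [Finite V] {G K : SimpleGraph V} (hle : K ≤ G)
    (hK : Minimal IsNonzeroEven K) : ∃ H ∈ cyclesOf G, H.spanningCoe = K := by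
  have hKa : ¬ K.IsAcyclic := fun h => hK.1.1 (hK.1.2.eq_bot_of_isAcyclic h)
  simp only [SimpleGraph.IsAcyclic, not_forall, not_not] at hKa
  obtain ⟨w, q, hq⟩ := hKa
  refine ⟨(q.mapLe hle).toSubgraph, ⟨w, q.mapLe hle, hq.mapLe hle, rfl⟩, ?_⟩
  have h1 := cyclesOf_minimal (H := (q.mapLe hle).toSubgraph) ⟨w, q.mapLe hle, hq.mapLe hle, rfl⟩
  refine hK.eq_of_le h1.1 ?_
  intro a b hab
  rw [SimpleGraph.Subgraph.spanningCoe_adj, SimpleGraph.Walk.adj_toSubgraph_mapLe] at hab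
  exact hab.adj_sub

/-- A `Subgraph` also carries a vertex set; a cycle has no isolated vertices, so its edges determine
it. -/
theorem injOn_spanningCoe_cyclesOf {V : Type*} (G : SimpleGraph V) :
    Set.InjOn SimpleGraph.Subgraph.spanningCoe (cyclesOf G) := by
  have hverts : ∀ H ∈ cyclesOf G, H.verts = {v | ∃ w, H.spanningCoe.Adj v w} := by
    rintro H ⟨u, p, hp, rfl⟩
    ext v
    constructor
    · intro hv
      have := hp.ncard_neighborSet_toSubgraph_eq_two (by simpa using hv)
      obtain ⟨w, hw⟩ := Set.nonempty_of_ncard_ne_zero (by rw [this]; decide)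
      exact ⟨w, hw⟩
    · rintro ⟨w, hw⟩
      exact p.toSubgraph.edge_vert hw
  intro H hH K hK h
  ext a b
  · rw [hverts H hH, hverts K hK, h]
  · rw [← SimpleGraph.Subgraph.spanningCoe_adj, h, SimpleGraph.Subgraph.spanningCoe_adj]

theorem cycleCount_eq_ncard_minimal {V : Type*} [Finite V] (G : SimpleGraph V) :
    cycleCount G = {K : SimpleGraph V | K ≤ G ∧ Minimal IsNonzeroEven K}.ncard := by
  rw [cycleCount, ← (injOn_spanningCoe_cyclesOf G).ncard_image]
  congr 1
  ext K
  constructor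
  · rintro ⟨H, hH, rfl⟩
    exact ⟨H.spanningCoe_le, cyclesOf_minimal hH⟩
  · rintro ⟨hle, hK⟩
    exact exists_mem_cyclesOf_of_minimal hle hK

/-! ### Existence of the maximum `Psi r`. -/

/-- Two even subgraphs that agree off a spanning tree have an even symmetric difference inside the
tree, which is empty. Exactly `r` edges lie off the tree. -/
theorem cycleCount_le_two_pow {V : Type*} [Finite V] {G : SimpleGraph V} (hG : G.Connected) {r : ℕ}
    (hr : cyclomaticNumber G = r) : cycleCount G ≤ 2 ^ r := by
  classical
  have := Fintype.ofFinite V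
  obtain ⟨T, hTG, hT⟩ := hG.exists_isTree_le
  have hTc := hT.card_edgeFinset
  have hcard : (G.edgeSet \ T.edgeSet).ncard = r := by
    have h1 := Set.ncard_sdiff_add_ncard_of_subset (SimpleGraph.edgeSet_mono hTG) (Set.toFinite _)
    have h2 : T.edgeSet.ncard = T.edgeFinset.card := by
      rw [← Set.ncard_coe_finset, SimpleGraph.coe_edgeFinset]
    rw [cyclomaticNumber, Nat.card_eq_fintype_card] at hr
    omega
  rw [cycleCount_eq_ncard_minimal, ← hcard, ← Set.ncard_powerset _ (Set.toFinite _)]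
  refine Set.ncard_le_ncard_of_injOn (fun K => K.edgeSet \ T.edgeSet) ?_ ?_ (Set.toFinite _)
  · rintro K ⟨hK, -⟩
    exact Set.sdiff_subset_sdiff_left (SimpleGraph.edgeSet_mono hK)
  · rintro K ⟨-, hK⟩ L ⟨-, hL⟩ h
    have hle : symmDiff K L ≤ T := by
      intro a b hab
      by_contra hT
      have := Set.ext_iff.mp h s(a, b)
      simp only [Set.mem_sdiff, SimpleGraph.mem_edgeSet, hT, not_false_eq_true, and_true] at this
      simp [symmDiff, this] at hab
    have := (evenDegrees_symmDiff hK.1.2 hL.1.2).eq_bot_of_isAcyclic (hT.isAcyclic.anti hle)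
    exact symmDiff_eq_bot.mp this

/-- Needed because `sSup` on `ℕ` takes the default value 0 on unbounded sets. -/
theorem bddAbove_cycleCounts (r : ℕ) : BddAbove (cycleCounts r) := by
  refine ⟨2 ^ r, ?_⟩
  rintro c ⟨V, _, G, hG, hr, rfl⟩
  exact cycleCount_le_two_pow hG hr

theorem isGreatest_Psi {r : ℕ} (h : (cycleCounts r).Nonempty) :
    IsGreatest (cycleCounts r) (Psi r) :=
  ⟨Nat.sSup_mem h (bddAbove_cycleCounts r), fun _ hc => le_csSup (bddAbove_cycleCounts r) hc⟩

/-! ### Boolean encoding of the subgraphs of `MC k`. -/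

/-- The index of the vertex `y` to which the rung at `x_z` leads. -/
def rungIndex {k : ℕ} (z : ZMod k) : ZMod k :=
  if z.val % 2 = 1 then z + 1 else if k % 2 = 1 ∧ z = 0 then z else z - 1

theorem ZMod.exists_natCast_lt {k : ℕ} (hk : k ≠ 0) (z : ZMod k) : ∃ v < k, z = (v : ZMod k) := by
  have : NeZero k := ⟨hk⟩
  exact ⟨z.val, z.val_lt, (ZMod.natCast_zmod_val z).symm⟩

theorem rungIndex_natCast {k v : ℕ} (h : v < k) :
    rungIndex (v : ZMod k) = if v % 2 = 1 then ((v + 1 : ℕ) : ZMod k)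
      else if k % 2 = 1 ∧ v = 0 then (0 : ZMod k) else (v : ZMod k) - 1 := by
  have h0 : ((v : ZMod k) = 0) ↔ v = 0 := by
    rw [ZMod.natCast_eq_zero_iff]
    exact ⟨fun hd => Nat.eq_zero_of_dvd_of_lt hd h, fun hv => hv ▸ dvd_zero k⟩
  unfold rungIndex
  simp only [ZMod.val_natCast_of_lt h, h0]
  split_ifs with h1 h2
  · push_cast; rfl
  · rw [h2.2]; simp
  · rfl

/-- Hence the rung at `y_j` is the rung at `x_(rungIndex j)`, and rungs can be indexed by their
`x`-ends alone. -/
theorem rungIndex_involutive {k : ℕ} (hk : 3 ≤ k) :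
    Function.Involutive (rungIndex : ZMod k → ZMod k) := by
  intro z
  obtain ⟨v, hv, rfl⟩ := ZMod.exists_natCast_lt (by omega) z
  rw [rungIndex_natCast hv]
  split_ifs with h1 h2
  · rcases Nat.lt_or_ge (v + 1) k with h | h
    · rw [rungIndex_natCast h, if_neg (by omega), if_neg (by omega)]
      push_cast; ring
    · have hk' : v + 1 = k := by omega
      have h0 : ((v + 1 : ℕ) : ZMod k) = ((0 : ℕ) : ZMod k) := by rw [hk']; simp
      rw [h0, rungIndex_natCast (by omega), if_neg (by omega), if_neg (by omega), ← h0]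
      push_cast; ring
  · have := rungIndex_natCast (k := k) (v := 0) (by omega)
    rw [Nat.cast_zero] at this
    rw [this, if_neg (by omega), if_pos (by omega), h2.2, Nat.cast_zero]
  · rcases Nat.eq_zero_or_pos v with h | h
    · subst h
      have : ((0 : ℕ) : ZMod k) - 1 = ((k - 1 : ℕ) : ZMod k) := by
        rw [Nat.cast_sub (by omega)]; simp
      rw [this, rungIndex_natCast (by omega), if_pos (by omega), Nat.sub_add_cancel (by omega)]
      simp
    · have : (v : ZMod k) - 1 = ((v - 1 : ℕ) : ZMod k) := by
        rw [Nat.cast_sub (by omega)]; simp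
      rw [this, rungIndex_natCast (by omega), if_pos (by omega), Nat.sub_add_cancel (by omega)]

/-- The subgraph of `MC k` whose edges are selected by the Boolean functions `a` (edges
`x_z x_{z+1}`), `b` (edges `y_z y_{z+1}`) and `c` (the rung at `x_z`). -/
def selectEdges {k : ℕ} (a b c : ZMod k → Bool) : SimpleGraph (ZMod k ⊕ ZMod k) :=
  SimpleGraph.fromRel fun u v =>
    match u, v with
    | .inl i, .inl j => j = i + 1 ∧ a i
    | .inr i, .inr j => j = i + 1 ∧ b i
    | .inl i, .inr j => j = rungIndex i ∧ c i
    | .inr _, .inl _ => False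

section
variable {k : ℕ} (a b c : ZMod k → Bool)

theorem one_ne_zero_zmod (hk : 3 ≤ k) : (1 : ZMod k) ≠ 0 := by
  have : Fact (1 < k) := ⟨by omega⟩
  exact one_ne_zero

theorem two_ne_zero_zmod (hk : 3 ≤ k) : (2 : ZMod k) ≠ 0 := by
  intro h
  have := (ZMod.natCast_eq_zero_iff 2 k).mp (by exact_mod_cast h)
  have := Nat.le_of_dvd (by norm_num) this
  omega

theorem selectEdges_inl_inl (hk : 3 ≤ k) (i j : ZMod k) :
    (selectEdges a b c).Adj (.inl i) (.inl j) ↔ (j = i + 1 ∧ a i) ∨ (i = j + 1 ∧ a j) := by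
  have h1 := one_ne_zero_zmod hk
  simp only [selectEdges, SimpleGraph.fromRel_adj, ne_eq, Sum.inl.injEq, and_iff_right_iff_imp]
  rintro (⟨h, -⟩ | ⟨h, -⟩) rfl <;> simp_all

theorem selectEdges_inr_inr (hk : 3 ≤ k) (i j : ZMod k) :
    (selectEdges a b c).Adj (.inr i) (.inr j) ↔ (j = i + 1 ∧ b i) ∨ (i = j + 1 ∧ b j) := by
  have h1 := one_ne_zero_zmod hk
  simp only [selectEdges, SimpleGraph.fromRel_adj, ne_eq, Sum.inr.injEq, and_iff_right_iff_imp]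
  rintro (⟨h, -⟩ | ⟨h, -⟩) rfl <;> simp_all

theorem selectEdges_inl_inr (i j : ZMod k) :
    (selectEdges a b c).Adj (.inl i) (.inr j) ↔ j = rungIndex i ∧ c i := by
  simp [selectEdges, SimpleGraph.fromRel_adj]

theorem selectEdges_inr_inl (i j : ZMod k) :
    (selectEdges a b c).Adj (.inr j) (.inl i) ↔ j = rungIndex i ∧ c i := by
  rw [SimpleGraph.adj_comm, selectEdges_inl_inr]

theorem selectEdges_top_eq_MC (hk : 3 ≤ k) :
    MC k = selectEdges (fun _ => true) (fun _ => true) (fun _ => true) := by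
  have h1 := one_ne_zero_zmod hk
  have hrung : ∀ i j : ZMod k, s(Sum.inl i, Sum.inr j) ∈
      railEdges k ∪ crossingRungs k ∪ straightRung k ↔ j = rungIndex i := by
    intro i j
    simp only [Set.mem_union, railEdges, crossingRungs, straightRung, Set.mem_ofPred_eq,
      Sym2.eq_iff, Sum.inl.injEq, Sum.inr.injEq, reduceCtorEq, false_and, and_false, or_false,
      exists_false, false_or, CharP.cast_eq_zero, Finset.mem_Icc]
    constructor
    · rintro (⟨t, ⟨ht, ht'⟩, ⟨rfl, rfl⟩ | ⟨rfl, rfl⟩⟩ | ⟨ho, rfl, rfl⟩)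
      · have : (2 * (t : ZMod k) - 1) = ((2 * t - 1 : ℕ) : ZMod k) := by
          rw [Nat.cast_sub (by omega)]; push_cast; rfl
        rw [this, rungIndex_natCast (by omega), if_pos (by omega), Nat.sub_add_cancel (by omega)]
        push_cast; rfl
      · rw [← rungIndex_involutive hk (2 * (t : ZMod k) - 1)]
        have : (2 * (t : ZMod k) - 1) = ((2 * t - 1 : ℕ) : ZMod k) := by
          rw [Nat.cast_sub (by omega)]; push_cast; rfl
        congr 1
        rw [this, rungIndex_natCast (by omega), if_pos (by omega), Nat.sub_add_cancel (by omega)]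
        push_cast; rfl
      · have := rungIndex_natCast (k := k) (v := 0) (by omega)
        rw [Nat.cast_zero] at this
        rw [this, if_neg (by omega), if_pos ⟨Nat.odd_iff.mp ho, rfl⟩]
    · rintro rfl
      obtain ⟨v, hv, rfl⟩ := ZMod.exists_natCast_lt (by omega) i
      rw [rungIndex_natCast hv]
      split_ifs with h h'
      · left
        refine ⟨(v + 1) / 2, by omega, Or.inl ?_⟩
        have : 2 * (((v + 1) / 2 : ℕ) : ZMod k) = ((v + 1 : ℕ) : ZMod k) := by
          have h3 : v + 1 = 2 * ((v + 1) / 2) := by omega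
          conv_rhs => rw [h3]
          push_cast; rfl
        rw [this]
        push_cast
        simp
      · right
        rw [h'.2]
        exact ⟨Nat.odd_iff.mpr h'.1, by simp, rfl⟩
      · left
        rcases Nat.eq_zero_or_pos v with h0 | h0
        · subst h0
          -- The residue 0 is the index `k`, and `k` is even here, so this is the last pair of
          -- crossing rungs.
          refine ⟨k / 2, by omega, Or.inr ?_⟩
          have : 2 * ((k / 2 : ℕ) : ZMod k) = 0 := by
            have h3 : k = 2 * (k / 2) := by omega
            calc 2 * ((k / 2 : ℕ) : ZMod k) = ((2 * (k / 2) : ℕ) : ZMod k) := by push_cast; rfl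
              _ = 0 := by rw [← h3]; simp
          rw [this]; simp
        · refine ⟨v / 2, by omega, Or.inr ?_⟩
          have : 2 * ((v / 2 : ℕ) : ZMod k) = (v : ZMod k) := by
            have h3 : v = 2 * (v / 2) := by omega
            conv_rhs => rw [h3]
            push_cast; rfl
          rw [this]; simp
  ext u v
  rcases u with i | i <;> rcases v with j | j
  · rw [selectEdges_inl_inl _ _ _ hk]
    simp only [MC, SimpleGraph.fromEdgeSet_adj, Set.mem_union, railEdges, crossingRungs,
      straightRung, Set.mem_ofPred_eq, Sym2.eq_iff, Sum.inl.injEq, reduceCtorEq, false_and,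
      and_false, or_false, exists_false, ne_eq, and_true]
    constructor
    · rintro ⟨⟨t, ⟨rfl, rfl⟩ | ⟨rfl, rfl⟩⟩, -⟩ <;> simp
    · rintro (rfl | rfl)
      · exact ⟨⟨i, by simp⟩, by simp [h1]⟩
      · exact ⟨⟨j, by simp⟩, by simp [h1]⟩
  · rw [selectEdges_inl_inr, MC, SimpleGraph.fromEdgeSet_adj, hrung]
    simp
  · rw [selectEdges_inr_inl, MC, SimpleGraph.fromEdgeSet_adj, Sym2.eq_swap, hrung]
    simp
  · rw [selectEdges_inr_inr _ _ _ hk]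
    simp only [MC, SimpleGraph.fromEdgeSet_adj, Set.mem_union, railEdges, crossingRungs,
      straightRung, Set.mem_ofPred_eq, Sym2.eq_iff, Sum.inr.injEq, reduceCtorEq, false_and,
      and_false, or_false, exists_false, ne_eq, and_true, false_or]
    constructor
    · rintro ⟨⟨t, ⟨rfl, rfl⟩ | ⟨rfl, rfl⟩⟩, -⟩ <;> simp
    · rintro (rfl | rfl)
      · exact ⟨⟨i, by simp⟩, by simp [h1]⟩
      · exact ⟨⟨j, by simp⟩, by simp [h1]⟩

theorem add_one_ne_sub_one (hk : 3 ≤ k) (j : ZMod k) : j + 1 ≠ j - 1 := by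
  intro h
  apply two_ne_zero_zmod hk
  linear_combination h

/-- With `k ≥ 3` distinct indices name distinct edges, so the selection can be read off the graph.
-/
theorem selectEdges_le_iff (hk : 3 ≤ k) {a b c a' b' c' : ZMod k → Bool} :
    selectEdges a b c ≤ selectEdges a' b' c' ↔ a ≤ a' ∧ b ≤ b' ∧ c ≤ c' := by
  have h2 : ∀ j : ZMod k, j ≠ j + 1 + 1 := by
    intro j h
    apply two_ne_zero_zmod hk
    linear_combination -h
  constructor
  · intro h
    refine ⟨fun j => ?_, fun j => ?_, fun j => ?_⟩
    · have := @h (.inl j) (.inl (j + 1))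
      rw [selectEdges_inl_inl _ _ _ hk, selectEdges_inl_inl _ _ _ hk] at this
      simp only [true_and, h2, false_and, or_false] at this
      exact Bool.le_iff_imp.mpr this
    · have := @h (.inr j) (.inr (j + 1))
      rw [selectEdges_inr_inr _ _ _ hk, selectEdges_inr_inr _ _ _ hk] at this
      simp only [true_and, h2, false_and, or_false] at this
      exact Bool.le_iff_imp.mpr this
    · have := @h (.inl j) (.inr (rungIndex j))
      rw [selectEdges_inl_inr, selectEdges_inl_inr] at this
      simp only [true_and] at this
      exact Bool.le_iff_imp.mpr this
  · rintro ⟨ha, hb, hc⟩ u v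
    have ha := fun j => Bool.le_iff_imp.mp (ha j)
    have hb := fun j => Bool.le_iff_imp.mp (hb j)
    have hc := fun j => Bool.le_iff_imp.mp (hc j)
    rcases u with i | i <;> rcases v with j | j
    · rw [selectEdges_inl_inl _ _ _ hk, selectEdges_inl_inl _ _ _ hk]
      exact Or.imp (And.imp_right (ha _)) (And.imp_right (ha _))
    · rw [selectEdges_inl_inr, selectEdges_inl_inr]
      exact And.imp_right (hc _)
    · rw [selectEdges_inr_inl, selectEdges_inr_inl]
      exact And.imp_right (hc _)
    · rw [selectEdges_inr_inr _ _ _ hk, selectEdges_inr_inr _ _ _ hk]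
      exact Or.imp (And.imp_right (hb _)) (And.imp_right (hb _))

theorem exists_selectEdges_of_le_MC (hk : 3 ≤ k) {H : SimpleGraph (ZMod k ⊕ ZMod k)}
    (hH : H ≤ MC k) : ∃ a b c : ZMod k → Bool, H = selectEdges a b c := by
  classical
  refine ⟨fun j => decide (H.Adj (.inl j) (.inl (j + 1))),
    fun j => decide (H.Adj (.inr j) (.inr (j + 1))),
    fun j => decide (H.Adj (.inl j) (.inr (rungIndex j))), ?_⟩
  rw [selectEdges_top_eq_MC hk] at hH
  ext u v
  have h := @hH u v
  rcases u with i | i <;> rcases v with j | j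
  · rw [selectEdges_inl_inl _ _ _ hk] at h ⊢
    simp only [and_true, decide_eq_true_eq] at h ⊢
    constructor
    · intro hij
      rcases h hij with rfl | rfl
      · exact Or.inl ⟨rfl, hij⟩
      · exact Or.inr ⟨rfl, hij.symm⟩
    · rintro (⟨rfl, hij⟩ | ⟨rfl, hij⟩)
      · exact hij
      · exact hij.symm
  · rw [selectEdges_inl_inr] at h ⊢
    simp only [and_true, decide_eq_true_eq] at h ⊢
    constructor
    · intro hij
      obtain rfl := h hij
      exact ⟨rfl, hij⟩
    · rintro ⟨rfl, hij⟩
      exact hij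
  · rw [selectEdges_inr_inl] at h ⊢
    simp only [and_true, decide_eq_true_eq] at h ⊢
    constructor
    · intro hij
      obtain rfl := h hij
      exact ⟨rfl, hij.symm⟩
    · rintro ⟨rfl, hij⟩
      exact hij.symm
  · rw [selectEdges_inr_inr _ _ _ hk] at h ⊢
    simp only [and_true, decide_eq_true_eq] at h ⊢
    constructor
    · intro hij
      rcases h hij with rfl | rfl
      · exact Or.inl ⟨rfl, hij⟩
      · exact Or.inr ⟨rfl, hij.symm⟩
    · rintro (⟨rfl, hij⟩ | ⟨rfl, hij⟩)
      · exact hij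
      · exact hij.symm

theorem ncard_three_of_ne {α : Type*} [DecidableEq α] {u v w : α} (huv : u ≠ v) (huw : u ≠ w)
    (hvw : v ≠ w) (p q r : Bool) :
    {z | (z = u ∧ p) ∨ (z = v ∧ q) ∨ (z = w ∧ r)}.ncard = p.toNat + q.toNat + r.toNat := by
  have h : {z | (z = u ∧ p) ∨ (z = v ∧ q) ∨ (z = w ∧ r)} =
      (((if p then {u} else ∅) ∪ (if q then {v} else ∅) ∪ (if r then {w} else ∅) : Finset α) :
        Set α) := by
    ext z
    cases p <;> cases q <;> cases r <;> simp
  rw [h, Set.ncard_coe_finset]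
  cases p <;> cases q <;> cases r <;> simp [huv, huw, hvw]

theorem ncard_neighborSet_selectEdges_inl (hk : 3 ≤ k) (j : ZMod k) :
    ((selectEdges a b c).neighborSet (.inl j)).ncard =
      (a j).toNat + (a (j - 1)).toNat + (c j).toNat := by
  classical
  rw [← ncard_three_of_ne (u := (.inl (j + 1) : ZMod k ⊕ ZMod k)) (v := .inl (j - 1))
    (w := .inr (rungIndex j)) (by simpa using add_one_ne_sub_one hk j) (by simp) (by simp)]
  congr 1
  ext z
  rcases z with i | i
  · rw [SimpleGraph.mem_neighborSet, selectEdges_inl_inl _ _ _ hk]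
    have : j = i + 1 ↔ i = j - 1 := by rw [eq_sub_iff_add_eq, eq_comm]
    rw [this]
    simp only [Set.mem_ofPred_eq, Sum.inl.injEq, reduceCtorEq, false_and, or_false]
    constructor
    · rintro (h | ⟨rfl, h⟩)
      · exact Or.inl h
      · exact Or.inr ⟨rfl, h⟩
    · rintro (h | ⟨rfl, h⟩)
      · exact Or.inl h
      · exact Or.inr ⟨rfl, h⟩
  · rw [SimpleGraph.mem_neighborSet, selectEdges_inl_inr]
    simp

theorem ncard_neighborSet_selectEdges_inr (hk : 3 ≤ k) (j : ZMod k) :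
    ((selectEdges a b c).neighborSet (.inr j)).ncard =
      (b j).toNat + (b (j - 1)).toNat + (c (rungIndex j)).toNat := by
  classical
  rw [← ncard_three_of_ne (u := (.inr (j + 1) : ZMod k ⊕ ZMod k)) (v := .inr (j - 1))
    (w := .inl (rungIndex j)) (by simpa using add_one_ne_sub_one hk j) (by simp) (by simp)]
  congr 1
  ext z
  rcases z with i | i
  · rw [SimpleGraph.mem_neighborSet, selectEdges_inr_inl]
    have : j = rungIndex i ↔ i = rungIndex j := by
      rw [← (rungIndex_involutive hk).eq_iff, eq_comm]
    rw [this]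
    simp only [Set.mem_ofPred_eq, Sum.inl.injEq, reduceCtorEq, false_and, false_or]
    constructor <;> rintro ⟨rfl, h⟩ <;> exact ⟨rfl, h⟩
  · rw [SimpleGraph.mem_neighborSet, selectEdges_inr_inr _ _ _ hk]
    have : j = i + 1 ↔ i = j - 1 := by rw [eq_sub_iff_add_eq, eq_comm]
    rw [this]
    simp only [Set.mem_ofPred_eq, Sum.inr.injEq, reduceCtorEq, false_and, or_false]
    constructor
    · rintro (h | ⟨rfl, h⟩)
      · exact Or.inl h
      · exact Or.inr ⟨rfl, h⟩
    · rintro (h | ⟨rfl, h⟩)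
      · exact Or.inl h
      · exact Or.inr ⟨rfl, h⟩

theorem even_toNat_add (p q r : Bool) :
    Even (p.toNat + q.toNat + r.toNat) ↔ r = (p ^^ q) := by
  revert p q r; decide

/-- Each vertex meets two rail edges and one rung. Evenness thus makes the rung the xor of the two
rail edges at either of its ends: the rails determine the rungs and must be compatible with each
other. -/
theorem evenDegrees_selectEdges_iff (hk : 3 ≤ k) :
    EvenDegrees (selectEdges a b c) ↔
      ∀ j, c j = (a j ^^ a (j - 1)) ∧ c (rungIndex j) = (b j ^^ b (j - 1)) := by
  constructor
  · intro h j
    have h1 := h (.inl j)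
    have h2 := h (.inr j)
    rw [ncard_neighborSet_selectEdges_inl _ _ _ hk, even_toNat_add] at h1
    rw [ncard_neighborSet_selectEdges_inr _ _ _ hk, even_toNat_add] at h2
    exact ⟨h1, h2⟩
  · rintro h (j | j)
    · rw [ncard_neighborSet_selectEdges_inl _ _ _ hk, even_toNat_add]
      exact (h j).1
    · rw [ncard_neighborSet_selectEdges_inr _ _ _ hk, even_toNat_add]
      exact (h j).2

end

/-! ### Connectedness and cyclomatic number of `MC k`. -/

theorem connected_MC {k : ℕ} (hk : 3 ≤ k) : (MC k).Connected := by
  rw [selectEdges_top_eq_MC hk]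
  set G := selectEdges (k := k) (fun _ => true) (fun _ => true) (fun _ => true) with hG
  have hx : ∀ v : ℕ, G.Reachable (.inl 0) (.inl (v : ZMod k)) := by
    intro v
    induction v with
    | zero => simp
    | succ v ih =>
      refine ih.trans (SimpleGraph.Adj.reachable ?_)
      rw [selectEdges_inl_inl _ _ _ hk]
      simp
  have hx' : ∀ z : ZMod k, G.Reachable (.inl 0) (.inl z) := by
    intro z
    obtain ⟨v, -, rfl⟩ := ZMod.exists_natCast_lt (by omega) z
    exact hx v
  have hall : ∀ u, G.Reachable (.inl 0) u := by
    rintro (z | z)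
    · exact hx' z
    · refine (hx' (rungIndex z)).trans (SimpleGraph.Adj.reachable ?_)
      rw [selectEdges_inl_inr, rungIndex_involutive hk]
      simp
  have : Nonempty (ZMod k ⊕ ZMod k) := ⟨.inl 0⟩
  exact ⟨fun u v => (hall u).symm.trans (hall v)⟩

/-- The graph is cubic on `2k` vertices, so it has `3k` edges. -/
theorem cyclomaticNumber_MC {k : ℕ} (hk : 3 ≤ k) : cyclomaticNumber (MC k) = (k : ℤ) + 1 := by
  classical
  have : NeZero k := ⟨by omega⟩
  have hdeg : ∀ v, (MC k).degree v = 3 := by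
    intro v
    rw [← SimpleGraph.card_neighborFinset_eq_degree, ← Set.ncard_coe_finset,
      SimpleGraph.coe_neighborFinset, selectEdges_top_eq_MC hk]
    rcases v with j | j
    · rw [ncard_neighborSet_selectEdges_inl _ _ _ hk]; rfl
    · rw [ncard_neighborSet_selectEdges_inr _ _ _ hk]; rfl
  have hsum := (MC k).sum_degrees_eq_twice_card_edges
  simp only [hdeg, Finset.sum_const, Finset.card_univ, Fintype.card_sum, ZMod.card,
    smul_eq_mul] at hsum
  rw [cyclomaticNumber, ← SimpleGraph.coe_edgeFinset, Set.ncard_coe_finset, Nat.card_sum,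
    Nat.card_zmod]
  push_cast
  omega

/-! ### Ring configurations and the local behaviour of a block. -/

/-- A configuration of a ring of `n` nodes: `x i` and `y i` select the two links between the nodes
`i` and `i + 1`, and `t i` selects one of the two ways to fill node `i`. -/
abbrev RingConfig (n : ℕ) : Type := (ZMod n → Bool) × (ZMod n → Bool) × (ZMod n → Bool)

/-- Inclusion of the contents of a block, a 4-cycle between the two left ports and the two right
ports, where `lx`, `ly`, `rx` are the states of three of its ports and `t` that of one edge. -/
abbrev BlockLe (lx ly rx t lx' ly' rx' t' : Bool) : Prop :=
  t ≤ t' ∧ (lx ^^ t) ≤ (lx' ^^ t') ∧ (rx ^^ t) ≤ (rx' ^^ t') ∧ (ly ^^ rx ^^ t) ≤ (ly' ^^ rx' ^^ t')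

/-- Inclusion of the contents of a column, a single edge that joins two vertices. -/
abbrev ColumnLe (lx rx lx' rx' : Bool) : Prop := (lx ^^ rx) ≤ (lx' ^^ rx')

/-- The configurations of the ring whose blocks are the nodes in `B`. The number of links between
consecutive nodes has constant parity. -/
def IsRingConfig {n : ℕ} (B : Finset (ZMod n)) (c : RingConfig n) : Prop :=
  (∀ i, (c.1 i ^^ c.2.1 i) = (c.1 (i + 1) ^^ c.2.1 (i + 1))) ∧ ∀ i ∉ B, c.2.2 i = false

/-- The empty configuration. -/
def zeroConfig (n : ℕ) : RingConfig n := (fun _ => false, fun _ => false, fun _ => false)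

/-- Inclusion of the edge sets that two configurations describe. -/
def RingLe {n : ℕ} (B : Finset (ZMod n)) (c d : RingConfig n) : Prop :=
  ∀ i, c.1 i ≤ d.1 i ∧ c.2.1 i ≤ d.2.1 i ∧
    (i + 1 ∈ B → BlockLe (c.1 i) (c.2.1 i) (c.1 (i + 1)) (c.2.2 (i + 1))
      (d.1 i) (d.2.1 i) (d.1 (i + 1)) (d.2.2 (i + 1))) ∧
    (i + 1 ∉ B → ColumnLe (c.1 i) (c.1 (i + 1)) (d.1 i) (d.1 (i + 1)))

/-- A minimal nonzero configuration. -/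
def IsMinimalConfig {n : ℕ} (B : Finset (ZMod n)) (c : RingConfig n) : Prop :=
  IsRingConfig B c ∧ c ≠ zeroConfig n ∧
    ∀ d, IsRingConfig B d → d ≠ zeroConfig n → RingLe B d c → d = c

namespace BlockLe
set_option maxRecDepth 10000

theorem eq_of_odd {a b a' b' : Bool} (h : (a' ^^ b') = true) (h' : (a ^^ b) = true)
    (ha : a ≤ a') (hb : b ≤ b') : a = a' ∧ b = b' := by
  revert a b a' b'; decide

theorem eq_false_of_even {a b a' b' : Bool} (h : (a' ^^ b') = true) (h' : (a ^^ b) = false)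
    (ha : a ≤ a') (hb : b ≤ b') : a = false ∧ b = false := by
  revert a b a' b'; decide

/-- A filling is determined by an upper bound with the same ports, if a port is in use. -/
theorem eq_of_same {lx ly rx t t' : Bool} (h : (lx || ly || rx) = true)
    (hle : BlockLe lx ly rx t lx ly rx t') : t = t' := by
  revert lx ly rx t t'; decide

theorem eq_false_of_used {lx ly rx t t' : Bool} (h : (lx || ly || rx) = true)
    (hle : BlockLe false false false t lx ly rx t') : t = false := by
  revert lx ly rx t t'; decide

/-- A block with all ports in use is filled by a perfect matching of left and right ports: straight
if `t'` is true, crossed if it is false. Whatever lies inside follows these two strands. -/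
theorem even_through {a b t t' : Bool} (hle : BlockLe a a b t true true true t') : a = b := by
  revert a b t t'; decide

theorem odd_through {a b t t' : Bool} (hle : BlockLe a (!a) b t true true true t') :
    b = (a ^^ !t') := by
  revert a b t t'; decide

theorem strand {a t : Bool} :
    BlockLe a (!a) (a ^^ !t) (t && a) true true true t := by
  revert a t; decide

theorem zero_le {a b c t : Bool} : BlockLe false false false false a b c t := by
  simp [BlockLe]

theorem refl {a b c t : Bool} : BlockLe a b c t a b c t := by
  simp [BlockLe]

end BlockLe

/-! ### Parity around the ring. -/

section parity
variable {n : ℕ} [NeZero n]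

theorem forall_zmod_of_succ {p : ZMod n → Prop} {j : ZMod n} (hj : p j)
    (h : ∀ i, p i → p (i + 1)) (i : ZMod n) : p i := by
  have key : ∀ d : ℕ, p (j + d) := by
    intro d
    induction d with
    | zero => simpa using hj
    | succ d ih => simpa [add_assoc] using h _ ih
  simpa using key (i - j).val

theorem IsRingConfig.parity {B : Finset (ZMod n)} {c : RingConfig n} (h : IsRingConfig B c)
    (i j : ZMod n) : (c.1 i ^^ c.2.1 i) = (c.1 j ^^ c.2.1 j) :=
  forall_zmod_of_succ (p := fun i => (c.1 i ^^ c.2.1 i) = (c.1 j ^^ c.2.1 j)) rfl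
    (fun i hi => (h.1 i).symm.trans hi) i

/-- Once around the ring `f` returns to its initial value, so it flips an even number of times. With
signs `±1`, the product over `f` is invariant under the shift and cancels. -/
theorem even_card_of_xor_succ {f g : ZMod n → Bool} (h : ∀ i, f (i + 1) = (f i ^^ g (i + 1))) :
    Even (Finset.univ.filter fun i => g i = true).card := by
  let s : Bool → ℤ := fun b => if b then -1 else 1
  have hs : ∀ a b, s (a ^^ b) = s a * s b := by decide
  have h0 : ∏ i, s (f i) ≠ 0 := Finset.prod_ne_zero_iff.mpr fun i _ => by
    simp only [s]; split_ifs <;> norm_num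
  have h1 : ∏ i, s (f (i + 1)) = ∏ i, s (f i) :=
    Equiv.prod_comp (Equiv.addRight (1 : ZMod n)) fun i => s (f i)
  have h2 : ∏ i, s (g (i + 1)) = ∏ i, s (g i) :=
    Equiv.prod_comp (Equiv.addRight (1 : ZMod n)) fun i => s (g i)
  simp_rw [h, hs] at h1
  rw [Finset.prod_mul_distrib, h2] at h1
  have h3 : ∏ i, s (g i) = 1 := mul_left_cancel₀ h0 (by rw [h1, mul_one])
  simp only [s] at h3
  rw [Finset.prod_ite] at h3
  simp only [Finset.prod_const, one_pow, mul_one] at h3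
  rwa [neg_one_pow_eq_one_iff_even (by norm_num)] at h3

/-- Take for `f` the parity of the partial sums of `g`; it closes up at the wrap-around because the
total is even. -/
theorem exists_xor_succ {g : ZMod n → Bool}
    (h : Even (Finset.univ.filter fun i => g i = true).card) :
    ∃ f : ZMod n → Bool, ∀ i, f (i + 1) = (f i ^^ g (i + 1)) := by
  let N : ℕ → ℕ := fun v => ∑ w ∈ Finset.range v, (g (w : ZMod n)).toNat
  have hN : N n = (Finset.univ.filter fun i => g i = true).card := by
    rw [Finset.card_filter]
    simp only [N]
    refine Finset.sum_bij' (fun w _ => (w : ZMod n)) (fun i _ => i.val) (by simp)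
      (fun i _ => by simpa using i.val_lt) (fun w hw => ZMod.val_natCast_of_lt (by simpa using hw))
      (by simp) (fun w _ => ?_)
    cases g (w : ZMod n) <;> simp
  have hstep : ∀ v, decide (N (v + 1) % 2 = 1) = (decide (N v % 2 = 1) ^^ g (v : ZMod n)) := by
    intro v
    simp only [N, Finset.sum_range_succ]
    rcases Nat.mod_two_eq_zero_or_one (∑ w ∈ Finset.range v, (g (w : ZMod n)).toNat) with h | h <;>
      cases g (v : ZMod n) <;> simp [Nat.add_mod, h]
  refine ⟨fun i => decide (N (i.val + 1) % 2 = 1), fun i => ?_⟩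
  simp only
  rw [hstep (i + 1).val]
  simp only [ZMod.natCast_val, ZMod.cast_id', id_eq]
  congr 1
  rcases Nat.lt_or_ge (i.val + 1) n with hi | hi
  · have : (i + 1).val = i.val + 1 := by
      have h2 : i + 1 = ((i.val + 1 : ℕ) : ZMod n) := by simp
      rw [h2, ZMod.val_natCast_of_lt hi]
    rw [this]
  · have hi' : i.val + 1 = n := le_antisymm i.val_lt hi
    have h2 : i + 1 = 0 := by
      have : i + 1 = ((i.val + 1 : ℕ) : ZMod n) := by simp
      rw [this, hi']; simp
    rw [h2, hi', ZMod.val_zero, hN, Nat.even_iff.mp h]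
    simp [N]

end parity

/-! ### Arcs of the ring. -/

/-- Membership of `j` in the arc `{i + 1, …, i + l}`. -/
def inArc {n : ℕ} (i : ZMod n) (l : ℕ) (j : ZMod n) : Bool := decide ((j - (i + 1)).val < l)

section arcs
variable {n : ℕ}

theorem inArc_add {i : ZMod n} {l d : ℕ} (hd : d < n) :
    inArc i l (i + 1 + d) = decide (d < l) := by
  simp [inArc, ZMod.val_natCast_of_lt hd]

theorem inArc_succ {i : ZMod n} {l : ℕ} (hl : 1 ≤ l) : inArc i l (i + 1) = true := by
  simp [inArc]; omega

variable [NeZero n]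

theorem exists_offset (i j : ZMod n) : ∃ d < n, j = i + 1 + (d : ZMod n) :=
  ⟨(j - (i + 1)).val, ZMod.val_lt _, by simp⟩

theorem add_last (i : ZMod n) : i + 1 + ((n - 1 : ℕ) : ZMod n) = i := by
  rw [Nat.cast_sub (NeZero.one_le)]; simp

theorem inArc_self {i : ZMod n} {l : ℕ} (hl : l < n) : inArc i l i = false := by
  have := inArc_add (i := i) (l := l) (d := n - 1) (by omega)
  rw [add_last] at this
  rw [this]
  simp; omega

/-- A pair of consecutive links seen from an arc: both ends of the pair come after the start of
the arc, or the pair is the one at its start. -/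
theorem offset_cases (i j : ZMod n) :
    (∃ d, d + 1 < n ∧ j = i + 1 + (d : ZMod n) ∧ j + 1 = i + 1 + ((d + 1 : ℕ) : ZMod n)) ∨
      j = i := by
  obtain ⟨d, hd, rfl⟩ := exists_offset i j
  rcases Nat.lt_or_ge (d + 1) n with h | h
  · exact Or.inl ⟨d, h, rfl, by push_cast; ring⟩
  · right
    have : d = n - 1 := by omega
    rw [this, add_last]

end arcs

/-! ### Which configurations are minimal. -/

section minimal
variable {n : ℕ} {B : Finset (ZMod n)} {c : RingConfig n}

theorem config_ext {c d : RingConfig n} (hx : ∀ i, c.1 i = d.1 i) (hy : ∀ i, c.2.1 i = d.2.1 i)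
    (ht : ∀ i, c.2.2 (i + 1) = d.2.2 (i + 1)) : c = d := by
  refine Prod.ext (funext hx) (Prod.ext (funext hy) (funext fun i => ?_))
  simpa using ht (i - 1)

/-- Lets an even configuration below `c` propagate along the stretches where `c` uses both links:
there it has both links throughout or none. -/
theorem through_even_of_le {d : RingConfig n} (hd : ∀ i, d.1 i = d.2.1 i) (hle : RingLe B d c)
    {i : ZMod n} (hx : c.1 i = true) (hy : c.2.1 i = true) (hx' : c.1 (i + 1) = true) :
    d.1 i = d.1 (i + 1) := by
  by_cases hi : i + 1 ∈ B
  · have := (hle i).2.2.1 hi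
    rw [← hd i, hx, hy, hx'] at this
    exact this.even_through
  · have := (hle i).2.2.2 hi
    rw [hx, hx'] at this
    revert this
    cases d.1 i <;> cases d.1 (i + 1) <;> simp [ColumnLe]

/-- The configuration that consists of the 4-cycle of one block. -/
def singleBlock (j : ZMod n) : RingConfig n :=
  (fun _ => false, fun _ => false, fun i => decide (i = j))

theorem isMinimalConfig_singleBlock {j : ZMod n} (hj : j ∈ B) :
    IsMinimalConfig B (singleBlock j) := by
  refine ⟨⟨fun i => rfl, fun i hi => ?_⟩, fun h => ?_, fun d hd hd0 hle => ?_⟩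
  · simp only [singleBlock, decide_eq_false_iff_not]
    rintro rfl
    exact hi hj
  · have := congrFun (congrArg (fun c => c.2.2) h) j
    simp [singleBlock, zeroConfig] at this
  · have hx : ∀ i, d.1 i = false := fun i => Bool.eq_false_of_le_false (hle i).1
    have hy : ∀ i, d.2.1 i = false := fun i => Bool.eq_false_of_le_false (hle i).2.1
    have ht : ∀ i, d.2.2 i = true → i = j := by
      intro i hi
      have hB : i ∈ B := by
        by_contra hB
        rw [hd.2 i hB] at hi
        simp at hi
      have := ((hle (i - 1)).2.2.1 (by simpa using hB)).1
      simpa [singleBlock, hi, Bool.le_iff_imp] using this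
    have hj : d.2.2 j = true := by
      by_contra hj
      refine hd0 (config_ext hx hy fun i => ?_)
      by_contra hi
      have hi : d.2.2 (i + 1) = true := by simpa [zeroConfig] using hi
      exact hj (ht _ hi ▸ hi)
    refine config_ext hx hy fun i => ?_
    by_cases hi : i + 1 = j
    · simp [singleBlock, hi, hj]
    · have : d.2.2 (i + 1) = false := by
        by_contra h
        exact hi (ht _ (by simpa using h))
      simp [singleBlock, hi, this]

/-- At a block with a port in use the two fillings are complementary and nonempty, so neither
contains the other. Elsewhere `ht` makes the bit of `c` false, which forces that of `d`. -/
theorem eq_of_le_of_links_eq {d : RingConfig n} (hc : IsRingConfig B c) (hd : IsRingConfig B d)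
    (hle : RingLe B d c) (hx : ∀ i, d.1 i = c.1 i) (hy : ∀ i, d.2.1 i = c.2.1 i)
    (ht : ∀ i, (c.1 i || c.1 (i + 1)) = true ∨ c.2.2 (i + 1) = false) : d = c := by
  refine config_ext hx hy fun i => ?_
  by_cases hi : i + 1 ∈ B
  · have := (hle i).2.2.1 hi
    rw [hx, hy, hx] at this
    rcases ht i with h | h
    · refine this.eq_of_same ?_
      revert h
      cases c.1 i <;> cases c.2.1 i <;> simp
    · have h1 := this.1
      rw [h] at h1 ⊢
      exact Bool.eq_false_of_le_false h1
  · rw [hd.2 _ hi, hc.2 _ hi]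

theorem eq_zero_of_le_of_links_eq {d : RingConfig n} (hd : IsRingConfig B d)
    (hle : RingLe B d c) (hx : ∀ i, d.1 i = false) (hy : ∀ i, d.2.1 i = false)
    (ht : ∀ i, (c.1 i || c.1 (i + 1)) = true ∨ c.2.2 (i + 1) = false) : d = zeroConfig n := by
  refine config_ext hx hy fun i => ?_
  by_cases hi : i + 1 ∈ B
  · have := (hle i).2.2.1 hi
    rw [hx, hy, hx] at this
    rcases ht i with h | h
    · refine this.eq_false_of_used ?_
      revert h
      cases c.1 i <;> cases c.2.1 i <;> simp
    · have h1 := this.1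
      rw [h] at h1
      exact Bool.eq_false_of_le_false h1
  · exact hd.2 _ hi

variable [NeZero n]

/-- Below a configuration with one link per gap, an odd one has the same links and so the same
fillings. An even one has no links, and would need the whole 4-cycle of a block whose ports are in
use. -/
theorem isMinimalConfig_of_odd (hc : IsRingConfig B c) (h : (c.1 0 ^^ c.2.1 0) = true) :
    IsMinimalConfig B c := by
  have hodd : ∀ i, (c.1 i ^^ c.2.1 i) = true := fun i => (hc.parity i 0).trans h
  refine ⟨hc, ?_, fun d hd hd0 hle => ?_⟩
  · rintro rfl
    simp [zeroConfig] at h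
  cases hp : (d.1 0 ^^ d.2.1 0) with
  | true =>
    have he : ∀ i, d.1 i = c.1 i ∧ d.2.1 i = c.2.1 i := fun i =>
      BlockLe.eq_of_odd (hodd i) ((hd.parity i 0).trans hp) (hle i).1 (hle i).2.1
    refine config_ext (fun i => (he i).1) (fun i => (he i).2) fun i => ?_
    by_cases hi : i + 1 ∈ B
    · have := (hle i).2.2.1 hi
      rw [(he i).1, (he i).2, (he (i + 1)).1] at this
      refine this.eq_of_same ?_
      have := hodd i
      revert this
      cases c.1 i <;> cases c.2.1 i <;> simp
    · rw [hd.2 _ hi, hc.2 _ hi]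
  | false =>
    have he : ∀ i, d.1 i = false ∧ d.2.1 i = false := fun i =>
      BlockLe.eq_false_of_even (hodd i) ((hd.parity i 0).trans hp) (hle i).1 (hle i).2.1
    refine absurd (config_ext (fun i => (he i).1) (fun i => (he i).2) fun i => ?_) hd0
    by_cases hi : i + 1 ∈ B
    · have := (hle i).2.2.1 hi
      rw [(he i).1, (he i).2, (he (i + 1)).1] at this
      refine this.eq_false_of_used ?_
      have := hodd i
      revert this
      cases c.1 i <;> cases c.2.1 i <;> simp
    · exact hd.2 _ hi

/-- An odd configuration below would be a strand that closes up after one turn, switching sides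
exactly at the blocks with bit false; their number is odd. An even one has all links or none. -/
theorem isMinimalConfig_of_full (hc : IsRingConfig B c) (hx : ∀ i, c.1 i = true)
    (hy : ∀ i, c.2.1 i = true) (h : Odd (B.filter fun i => c.2.2 i = false).card) :
    IsMinimalConfig B c := by
  refine ⟨hc, ?_, fun d hd hd0 hle => ?_⟩
  · rintro rfl
    simpa [zeroConfig] using hx 0
  cases hp : (d.1 0 ^^ d.2.1 0) with
  | true =>
    exfalso
    have hy' : ∀ i, d.2.1 i = !d.1 i := by
      intro i
      have := (hd.parity i 0).trans hp
      revert this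
      cases d.1 i <;> cases d.2.1 i <;> simp
    have := even_card_of_xor_succ (f := d.1) (g := fun i => decide (i ∈ B) && !c.2.2 i) (by
      intro i
      by_cases hi : i + 1 ∈ B
      · have := (hle i).2.2.1 hi
        rw [hx, hx, hy, hy'] at this
        simp [hi, this.odd_through]
      · have := (hle i).2.2.2 hi
        rw [hx, hx] at this
        simp only [hi, decide_false, Bool.false_and, Bool.xor_false]
        revert this
        cases d.1 i <;> cases d.1 (i + 1) <;> simp [ColumnLe])
    rw [← Nat.not_even_iff_odd] at h
    apply h
    convert this using 2
    ext i
    simp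
  | false =>
    have he : ∀ i, d.1 i = d.2.1 i := by
      intro i
      have := (hd.parity i 0).trans hp
      revert this
      cases d.1 i <;> cases d.2.1 i <;> simp
    have hconst : ∀ i, d.1 i = d.1 0 := forall_zmod_of_succ (j := 0) rfl fun i hi =>
      (through_even_of_le he hle (hx i) (hy i) (hx _)).symm.trans hi
    cases h0 : d.1 0 with
    | true =>
      exact eq_of_le_of_links_eq hc hd hle (fun i => by rw [hconst, h0, hx])
        (fun i => by rw [← he, hconst, h0, hy]) (fun i => Or.inl (by simp [hx]))
    | false =>
      exact absurd (eq_zero_of_le_of_links_eq hd hle (fun i => by rw [hconst, h0])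
        (fun i => by rw [← he, hconst, h0]) (fun i => Or.inl (by simp [hx]))) hd0

theorem isMinimalConfig_of_arc (hc : IsRingConfig B c) {i : ZMod n} {l : ℕ} (hl : 1 ≤ l)
    (hln : l < n) (hx : ∀ j, c.1 j = inArc i l j) (hy : ∀ j, c.2.1 j = inArc i l j)
    (ht : ∀ j, c.2.2 j = true → inArc i (l + 1) j = true) : IsMinimalConfig B c := by
  refine ⟨hc, ?_, fun d hd hd0 hle => ?_⟩
  · rintro rfl
    have := hx (i + 1)
    rw [inArc_succ hl] at this
    simp [zeroConfig] at this
  -- Link `j` joins the nodes `j` and `j + 1`, so `l` consecutive gaps touch `l + 1` nodes.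
  have hsupp : ∀ j, (c.1 j || c.1 (j + 1)) = true ∨ c.2.2 (j + 1) = false := by
    intro j
    rcases offset_cases i j with ⟨e, he, hj, hj'⟩ | rfl
    · rcases Nat.lt_or_ge e l with h | h
      · left
        rw [hx, hj, inArc_add (by omega)]
        simp [h]
      · right
        by_contra hcon
        have := ht _ (by simpa using hcon)
        rw [hj', inArc_add he] at this
        simp at this
        omega
    · left
      rw [hx (j + 1), inArc_succ hl]
      simp
  have hdi : d.1 i = false ∧ d.2.1 i = false := by
    have h1 := (hle i).1
    have h2 := (hle i).2.1
    rw [hx, inArc_self hln] at h1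
    rw [hy, inArc_self hln] at h2
    exact ⟨Bool.eq_false_of_le_false h1, Bool.eq_false_of_le_false h2⟩
  have he : ∀ j, d.1 j = d.2.1 j := by
    intro j
    have := hd.parity j i
    rw [hdi.1, hdi.2] at this
    revert this
    cases d.1 j <;> cases d.2.1 j <;> simp
  have hprop : ∀ e : ℕ, e < l → d.1 (i + 1 + (e : ZMod n)) = d.1 (i + 1) := by
    intro e
    induction e with
    | zero => simp
    | succ e ih =>
      intro hel
      rw [← ih (by omega)]
      have hs : i + 1 + ((e + 1 : ℕ) : ZMod n) = i + 1 + (e : ZMod n) + 1 := by push_cast; ring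
      rw [hs]
      refine (through_even_of_le he hle ?_ ?_ ?_).symm
      · rw [hx, inArc_add (by omega)]; simp; omega
      · rw [hy, inArc_add (by omega)]; simp; omega
      · rw [← hs, hx, inArc_add (by omega)]; simp; omega
  have hout : ∀ j, inArc i l j = false → d.1 j = false := by
    intro j hj
    have h1 := (hle j).1
    rw [hx, hj] at h1
    exact Bool.eq_false_of_le_false h1
  have hin : ∀ j, inArc i l j = true → d.1 j = d.1 (i + 1) := by
    intro j hj
    obtain ⟨e, hen, rfl⟩ := exists_offset i j
    rw [inArc_add hen] at hj
    exact hprop e (by simpa using hj)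
  cases h0 : d.1 (i + 1) with
  | true =>
    have hdx : ∀ j, d.1 j = inArc i l j := by
      intro j
      cases hj : inArc i l j with
      | true => rw [hin j hj, h0]
      | false => exact hout j hj
    exact eq_of_le_of_links_eq hc hd hle (fun j => by rw [hdx, hx])
      (fun j => by rw [← he, hdx, hy]) hsupp
  | false =>
    have hdx : ∀ j, d.1 j = false := by
      intro j
      cases hj : inArc i l j with
      | true => rw [hin j hj, h0]
      | false => exact hout j hj
    exact absurd (eq_zero_of_le_of_links_eq hd hle hdx (fun j => by rw [← he, hdx]) hsupp) hd0

/-- The part of a configuration with even parity that lies on an arc. -/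
def restrictArc (i : ZMod n) (l : ℕ) (t : ZMod n → Bool) : RingConfig n :=
  (inArc i l, inArc i l, fun j => t j && inArc i (l + 1) j)

/-- Start where the links switch on and stop where they first switch off. The restriction to this
arc is a nonzero configuration below `c`, hence `c` itself. -/
theorem IsMinimalConfig.exists_arc (hc : IsMinimalConfig B c) (he : ∀ i, c.1 i = c.2.1 i)
    (h0 : ∃ i, c.1 i = false) (h1 : ∃ i, c.1 i = true) :
    ∃ i l, 1 ≤ l ∧ l < n ∧ c = restrictArc i l c.2.2 := by
  classical
  obtain ⟨i, hi, hi'⟩ : ∃ i, c.1 i = false ∧ c.1 (i + 1) = true := by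
    by_contra! hcon
    obtain ⟨j, hj⟩ := h0
    obtain ⟨j', hj'⟩ := h1
    have := forall_zmod_of_succ (p := fun i => c.1 i = false) hj
      (fun i hi => by simpa using hcon i hi) j'
    simp [hj'] at this
  have hex : ∃ d : ℕ, c.1 (i + 1 + (d : ZMod n)) = false := ⟨n - 1, by rw [add_last, hi]⟩
  set l := Nat.find hex with hl
  have hlf : c.1 (i + 1 + (l : ZMod n)) = false := Nat.find_spec hex
  have hlt : ∀ d < l, c.1 (i + 1 + (d : ZMod n)) = true := fun d hd => by
    simpa using Nat.find_min hex hd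
  have hl1 : 1 ≤ l := by
    by_contra h
    have : l = 0 := by omega
    rw [this] at hlf
    simp [hi'] at hlf
  have hln : l < n := by
    have : l ≤ n - 1 := Nat.find_min' hex (by rw [add_last, hi])
    have := NeZero.one_le (n := n)
    omega
  refine ⟨i, l, hl1, hln, (hc.2.2 _ ⟨fun j => by simp [restrictArc], fun j hj => ?_⟩ ?_ ?_).symm⟩
  · simp [restrictArc, hc.1.2 j hj]
  · intro h
    have := congrFun (congrArg (fun c => c.1) h) (i + 1)
    simp [restrictArc, zeroConfig, inArc_succ hl1] at this
  · have hle : ∀ j, inArc i l j ≤ c.1 j := by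
      intro j
      rw [Bool.le_iff_imp]
      obtain ⟨d, hd, rfl⟩ := exists_offset i j
      rw [inArc_add hd]
      intro h
      exact hlt d (by simpa using h)
    intro j
    refine ⟨hle j, he j ▸ hle j, ?_⟩
    -- At each node the restriction either agrees with `c` or is empty.
    have key : (inArc i l j = c.1 j ∧ inArc i l (j + 1) = c.1 (j + 1) ∧
        inArc i (l + 1) (j + 1) = true) ∨ (inArc i l j = false ∧ inArc i l (j + 1) = false ∧
        inArc i (l + 1) (j + 1) = false) := by
      rcases offset_cases i j with ⟨d, hd, hj, hj'⟩ | rfl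
      · rw [hj', hj, inArc_add (by omega), inArc_add hd, inArc_add hd]
        rcases Nat.lt_or_ge d l with h | h
        · left
          refine ⟨by simp [h, hlt d h], ?_, by simp [h]⟩
          rcases Nat.lt_or_ge (d + 1) l with h' | h'
          · simp [h', hlt (d + 1) h', -Nat.cast_add]
          · have : d + 1 = l := by omega
            rw [this, hlf]
            simp
        · right
          simp
          omega
      · left
        rw [inArc_self hln, hi, inArc_succ hl1, hi', inArc_succ (by omega)]
        simp
    rcases key with ⟨k1, k2, k3⟩ | ⟨k1, k2, k3⟩
    · simp only [restrictArc, k1, k2, k3, ← he, Bool.and_true]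
      exact ⟨fun _ => BlockLe.refl, fun _ => le_rfl⟩
    · simp only [restrictArc, k1, k2, k3, Bool.and_false]
      exact ⟨fun _ => BlockLe.zero_le, fun _ => by simp [ColumnLe]⟩

theorem IsMinimalConfig.odd_of_full (hc : IsMinimalConfig B c) (hx : ∀ i, c.1 i = true)
    (hy : ∀ i, c.2.1 i = true) : Odd (B.filter fun i => c.2.2 i = false).card := by
  by_contra hodd
  rw [Nat.not_odd_iff_even] at hodd
  obtain ⟨f, hf⟩ := exists_xor_succ (g := fun i => decide (i ∈ B) && !c.2.2 i) (by
    convert hodd using 2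
    ext i
    simp)
  -- With an even number of crossings one strand closes up by itself and is strictly smaller. It
  -- uses the edge `x`–`x` of node `i` iff the node is straight and the strand enters it on the `x`
  -- side.
  have := hc.2.2 (f, fun i => !f i, fun i => c.2.2 i && f (i - 1))
    ⟨fun i => by simp, fun i hi => by simp [hc.1.2 i hi]⟩ (fun h => ?_) (fun i => ?_)
  · have h1 := congrFun (congrArg (fun c => c.1) this) 0
    have h2 := congrFun (congrArg (fun c => c.2.1) this) 0
    simp only at h1 h2
    rw [h1, hx, hy] at h2
    simp at h2
  · have h1 := congrFun (congrArg (fun c => c.1) h) 0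
    have h2 := congrFun (congrArg (fun c => c.2.1) h) 0
    simp only [zeroConfig] at h1 h2
    simp [h1] at h2
  · simp only [add_sub_cancel_right, hx, hy]
    refine ⟨Bool.le_true _, Bool.le_true _, fun hi => ?_, fun hi => ?_⟩
    · rw [hf]
      simp only [hi, decide_true, Bool.true_and]
      exact BlockLe.strand
    · rw [hf]
      simp [hi, ColumnLe]

theorem IsMinimalConfig.eq_singleBlock (hc : IsMinimalConfig B c) (hx : ∀ i, c.1 i = false)
    (hy : ∀ i, c.2.1 i = false) : ∃ j ∈ B, c = singleBlock j := by
  obtain ⟨j, hj⟩ : ∃ j, c.2.2 j = true := by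
    by_contra! h
    exact hc.2.1 (config_ext hx hy fun i => by simpa [zeroConfig] using h (i + 1))
  have hB : j ∈ B := by
    by_contra h
    rw [hc.1.2 j h] at hj
    simp at hj
  have hm := isMinimalConfig_singleBlock hB
  refine ⟨j, hB, (hc.2.2 _ hm.1 hm.2.1 fun i => ?_).symm⟩
  simp only [singleBlock, hx, hy]
  refine ⟨le_rfl, le_rfl, fun _ => ?_, fun _ => le_rfl⟩
  by_cases h : i + 1 = j
  · simp [h, hj, BlockLe]
  · simp only [h, decide_false]
    exact BlockLe.zero_le

end minimal

/-! ### Counting the minimal configurations. -/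

section count
variable {n : ℕ} [NeZero n] (B : Finset (ZMod n))

/-- The Boolean functions that vanish outside `B`. -/
def fillings : Finset (ZMod n → Bool) :=
  Fintype.piFinset fun j => if j ∈ B then Finset.univ else {false}

variable {B} in
theorem mem_fillings {t : ZMod n → Bool} : t ∈ fillings B ↔ ∀ j ∉ B, t j = false := by
  simp only [fillings, Fintype.mem_piFinset]
  refine forall_congr' fun j => ?_
  by_cases h : j ∈ B <;> simp [h]

theorem card_fillings : (fillings B).card = 2 ^ B.card := by
  rw [fillings, Fintype.card_piFinset]
  simp only [apply_ite Finset.card, Finset.card_univ, Fintype.card_bool, Finset.card_singleton]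
  rw [Finset.prod_ite_mem]
  simp

/-- Flipping the bit at a fixed block exchanges odd and even fillings, so each parity takes half of
them. -/
theorem card_odd_fillings (hB : B.Nonempty) :
    ((fillings B).filter fun t => Odd (B.filter fun i => t i = false).card).card =
      2 ^ (B.card - 1) := by
  classical
  obtain ⟨j, hj⟩ := hB
  set P : (ZMod n → Bool) → Prop := fun t => Odd (B.filter fun i => t i = false).card with hP
  have hflip : ∀ t, P (Function.update t j (!t j)) ↔ ¬ P t := by
    intro t
    have h : ∀ s : ZMod n → Bool, (B.filter fun i => s i = false).card =
        ((B.erase j).filter fun i => s i = false).card + (!s j).toNat := by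
      intro s
      conv_lhs => rw [← Finset.insert_erase hj]
      rw [Finset.filter_insert]
      cases hs : s j <;> simp
    have h' : ((B.erase j).filter fun i => Function.update t j (!t j) i = false) =
        (B.erase j).filter fun i => t i = false := by
      refine Finset.filter_congr fun i hi => ?_
      rw [Function.update_of_ne (Finset.ne_of_mem_erase hi)]
    simp only [hP]
    rw [h, h t, h']
    cases t j <;> simp [Nat.odd_add_one]
  have hcard : ((fillings B).filter P).card = ((fillings B).filter fun t => ¬ P t).card := by
    refine Finset.card_bij' (fun t _ => Function.update t j (!t j))
      (fun t _ => Function.update t j (!t j)) ?_ ?_ (by simp) (by simp)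
    all_goals
      intro t ht
      rw [Finset.mem_filter, mem_fillings] at ht ⊢
      refine ⟨fun i hi => ?_, ?_⟩
      · rw [Function.update_of_ne (by rintro rfl; exact hi hj), ht.1 i hi]
      · rw [hflip]
        simpa using ht.2
  have hsum := Finset.card_filter_add_card_filter_not (s := fillings B) P
  rw [card_fillings, ← hcard] at hsum
  change ((fillings B).filter P).card = _
  have hpos : 0 < B.card := Finset.card_pos.mpr ⟨j, hj⟩
  have : 2 ^ B.card = 2 * 2 ^ (B.card - 1) := by
    rw [← pow_succ', Nat.sub_add_cancel hpos]
  omega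

/-- The arc `{i + 1, …, i + l}`. -/
def arc (i : ZMod n) (l : ℕ) : Finset (ZMod n) := Finset.univ.filter fun j => inArc i l j = true

theorem mem_arc {i j : ZMod n} {l : ℕ} : j ∈ arc i l ↔ inArc i l j = true := by simp [arc]

/-- Minimal configurations with one link between any two consecutive nodes. -/
def oddConfigs : Finset (RingConfig n) :=
  (Finset.univ ×ˢ fillings B).image fun p => (p.1, fun i => !p.1 i, p.2)

/-- Minimal configurations with two links between any two consecutive nodes. -/
def fullConfigs : Finset (RingConfig n) :=
  ((fillings B).filter fun t => Odd (B.filter fun i => t i = false).card).image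
    fun t => (fun _ => true, fun _ => true, t)

/-- Minimal configurations with no links. -/
def blockConfigs : Finset (RingConfig n) := B.image singleBlock

/-- Minimal configurations whose links fill an arc. -/
def arcConfigs : Finset (RingConfig n) :=
  ((Finset.univ ×ˢ Finset.Icc 1 (n - 1)).sigma
      fun p : ZMod n × ℕ => fillings (B ∩ arc p.1 (p.2 + 1))).image
    fun q => (inArc q.1.1 q.1.2, inArc q.1.1 q.1.2, q.2)

theorem card_oddConfigs : (oddConfigs B).card = 2 ^ (n + B.card) := by
  rw [oddConfigs, Finset.card_image_of_injective, Finset.card_product, card_fillings]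
  · simp [pow_add, ZMod.card]
  · rintro ⟨x, t⟩ ⟨x', t'⟩ h
    simp only [Prod.mk.injEq] at h ⊢
    exact ⟨h.1, h.2.2⟩

theorem card_fullConfigs (hB : B.Nonempty) : (fullConfigs B).card = 2 ^ (B.card - 1) := by
  rw [fullConfigs, Finset.card_image_of_injective, card_odd_fillings B hB]
  intro t t' h
  simpa using h

theorem card_blockConfigs : (blockConfigs B).card = B.card := by
  rw [blockConfigs, Finset.card_image_of_injective]
  intro i j h
  have := congrFun (congrArg (fun c => c.2.2) h) i
  simpa [singleBlock] using this

/-- The start of a proper nonempty arc is the only place where membership switches on. -/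
theorem inArc_inj {i i' : ZMod n} {l l' : ℕ} (hl : 1 ≤ l) (hln : l < n)
    (hln' : l' < n) (h : inArc i l = inArc i' l') : i = i' ∧ l = l' := by
  have hi : i = i' := by
    have h1 : inArc i' l' i = false := by rw [← h, inArc_self hln]
    have h2 : inArc i' l' (i + 1) = true := by rw [← h, inArc_succ hl]
    rcases offset_cases i' i with ⟨d, hd, hj, hj'⟩ | h
    · rw [hj, inArc_add (by omega)] at h1
      rw [hj', inArc_add hd] at h2
      simp at h1 h2
      omega
    · exact h
  subst hi
  refine ⟨rfl, ?_⟩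
  have h1 : decide (l < l) = decide (l < l') := by
    rw [← inArc_add (i := i) hln, ← inArc_add (i := i) hln, h]
  have h2 : decide (l' < l) = decide (l' < l') := by
    rw [← inArc_add (i := i) hln', ← inArc_add (i := i) hln', h]
  simp at h1 h2
  omega

theorem card_arcConfigs : (arcConfigs B).card =
    ∑ i : ZMod n, ∑ l ∈ Finset.Icc 1 (n - 1), 2 ^ (B ∩ arc i (l + 1)).card := by
  rw [arcConfigs, Finset.card_image_of_injOn, Finset.card_sigma, Finset.sum_product]
  · simp only [card_fillings]
  · rintro ⟨⟨i, l⟩, t⟩ hq ⟨⟨i', l'⟩, t'⟩ hq' h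
    have hn := NeZero.one_le (n := n)
    simp only [Finset.coe_sigma, Set.mem_sigma_iff, Finset.mem_coe, Finset.mem_product,
      Finset.mem_Icc] at hq hq'
    simp only [Prod.mk.injEq] at h
    obtain ⟨rfl, rfl⟩ := inArc_inj hq.1.2.1 (by omega) (by omega) h.1
    rw [h.2.2]

/-- The parity of the links separates the first class; in the even case the links are all present,
all absent, or mixed. -/
theorem isMinimalConfig_iff (c : RingConfig n) : IsMinimalConfig B c ↔
    c ∈ oddConfigs B ∪ (fullConfigs B ∪ (blockConfigs B ∪ arcConfigs B)) := by
  have hn := NeZero.one_le (n := n)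
  simp only [Finset.mem_union]
  constructor
  · intro hc
    cases hp : (c.1 0 ^^ c.2.1 0) with
    | true =>
      left
      rw [oddConfigs, Finset.mem_image]
      refine ⟨(c.1, c.2.2), by simpa [mem_fillings] using hc.1.2, ?_⟩
      refine Prod.ext rfl (Prod.ext (funext fun i => ?_) rfl)
      have := (hc.1.parity i 0).trans hp
      revert this
      simp only
      cases c.1 i <;> cases c.2.1 i <;> simp
    | false =>
      right
      have he : ∀ i, c.1 i = c.2.1 i := by
        intro i
        have := (hc.1.parity i 0).trans hp
        revert this
        cases c.1 i <;> cases c.2.1 i <;> simp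
      by_cases h0 : ∃ i, c.1 i = false
      · right
        by_cases h1 : ∃ i, c.1 i = true
        · right
          obtain ⟨i, l, hl, hln, h⟩ := hc.exists_arc he h0 h1
          rw [arcConfigs, Finset.mem_image]
          refine ⟨⟨(i, l), fun j => c.2.2 j && inArc i (l + 1) j⟩, ?_, ?_⟩
          · simp only [Finset.mem_sigma, Finset.mem_product, Finset.mem_univ, true_and,
              Finset.mem_Icc, mem_fillings, Finset.mem_inter, mem_arc]
            refine ⟨by omega, fun j hj => ?_⟩
            by_cases hjB : j ∈ B
            · simp only [hjB, true_and, Bool.not_eq_true] at hj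
              simp [hj]
            · simp [hc.1.2 j hjB]
          · conv_rhs => rw [h]
            rfl
        · left
          have h1 : ∀ i, c.1 i = false := by simpa using h1
          obtain ⟨j, hj, rfl⟩ := hc.eq_singleBlock h1 fun i => by rw [← he, h1]
          exact Finset.mem_image_of_mem _ hj
      · left
        have h0 : ∀ i, c.1 i = true := by simpa using h0
        have h0' : ∀ i, c.2.1 i = true := fun i => by rw [← he, h0]
        rw [fullConfigs, Finset.mem_image]
        refine ⟨c.2.2, ?_, ?_⟩
        · rw [Finset.mem_filter, mem_fillings]
          exact ⟨hc.1.2, hc.odd_of_full h0 h0'⟩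
        · exact Prod.ext (funext fun i => (h0 i).symm) (Prod.ext (funext fun i => (h0' i).symm) rfl)
  · rintro (h | h | h | h)
    · obtain ⟨⟨x, t⟩, ht, rfl⟩ := Finset.mem_image.mp h
      simp only [Finset.mem_product, Finset.mem_univ, true_and, mem_fillings] at ht
      exact isMinimalConfig_of_odd ⟨fun i => by simp, ht⟩ (by simp)
    · obtain ⟨t, ht, rfl⟩ := Finset.mem_image.mp h
      rw [Finset.mem_filter, mem_fillings] at ht
      exact isMinimalConfig_of_full ⟨fun i => by simp, ht.1⟩ (fun _ => rfl) (fun _ => rfl) ht.2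
    · obtain ⟨j, hj, rfl⟩ := Finset.mem_image.mp h
      exact isMinimalConfig_singleBlock hj
    · obtain ⟨⟨⟨i, l⟩, t⟩, hq, rfl⟩ := Finset.mem_image.mp h
      simp only [Finset.mem_sigma, Finset.mem_product, Finset.mem_univ, true_and,
        Finset.mem_Icc, mem_fillings, Finset.mem_inter, mem_arc] at hq
      refine isMinimalConfig_of_arc (i := i) (l := l) ⟨fun i => by simp, fun j hj => ?_⟩
        hq.1.1 (by omega) (fun _ => rfl) (fun _ => rfl) fun j hj => ?_
      · exact hq.2 j fun h => hj h.1
      · by_contra hcon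
        have := hq.2 j fun h => hcon h.2
        simp [this] at hj

theorem ncard_isMinimalConfig (hB : B.Nonempty) : {c | IsMinimalConfig B c}.ncard =
    2 ^ (n + B.card) + (2 ^ (B.card - 1) + (B.card +
      ∑ i : ZMod n, ∑ l ∈ Finset.Icc 1 (n - 1), 2 ^ (B ∩ arc i (l + 1)).card)) := by
  have hn := NeZero.one_le (n := n)
  have h : {c | IsMinimalConfig B c} =
      ((oddConfigs B ∪ (fullConfigs B ∪ (blockConfigs B ∪ arcConfigs B)) :
        Finset (RingConfig n)) : Set (RingConfig n)) := by
    ext c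
    exact isMinimalConfig_iff B c
  have hodd : ∀ c ∈ oddConfigs B, (c.1 0 ^^ c.2.1 0) = true := by
    intro c hc
    obtain ⟨p, -, rfl⟩ := Finset.mem_image.mp hc
    simp
  have hfull : ∀ c ∈ fullConfigs B, (∀ i, c.1 i = true) ∧ ∀ i, c.1 i = c.2.1 i := by
    intro c hc
    obtain ⟨p, -, rfl⟩ := Finset.mem_image.mp hc
    simp
  have hblock : ∀ c ∈ blockConfigs B, (∀ i, c.1 i = false) ∧ ∀ i, c.1 i = c.2.1 i := by
    intro c hc
    obtain ⟨p, -, rfl⟩ := Finset.mem_image.mp hc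
    simp [singleBlock]
  have harc : ∀ c ∈ arcConfigs B, (∃ i, c.1 i = false) ∧ (∃ i, c.1 i = true) ∧
      ∀ i, c.1 i = c.2.1 i := by
    intro c hc
    obtain ⟨⟨⟨i, l⟩, t⟩, hq, rfl⟩ := Finset.mem_image.mp hc
    simp only [Finset.mem_sigma, Finset.mem_product, Finset.mem_univ, true_and,
      Finset.mem_Icc] at hq
    have hq2 := hq.1.2
    exact ⟨⟨i, inArc_self (show l < n by omega)⟩, ⟨i + 1, inArc_succ hq.1.1⟩, fun _ => rfl⟩
  rw [h, Set.ncard_coe_finset, Finset.card_union_of_disjoint, Finset.card_union_of_disjoint,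
    Finset.card_union_of_disjoint, card_oddConfigs, card_fullConfigs B hB, card_blockConfigs,
    card_arcConfigs]
  · rw [Finset.disjoint_left]
    intro c h1 h2
    obtain ⟨-, ⟨i, hi⟩, -⟩ := harc c h2
    simp [(hblock c h1).1] at hi
  · rw [Finset.disjoint_left]
    intro c h1 h2
    rcases Finset.mem_union.mp h2 with h2 | h2
    · have := (hblock c h2).1 0
      simp [(hfull c h1).1] at this
    · obtain ⟨⟨i, hi⟩, -⟩ := harc c h2
      simp [(hfull c h1).1] at hi
  · rw [Finset.disjoint_left]
    intro c h1 h2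
    have h3 := hodd c h1
    simp only [Finset.mem_union] at h2
    rcases h2 with h2 | h2 | h2
    · simp [(hfull c h2).2] at h3
    · simp [(hblock c h2).2] at h3
    · simp [(harc c h2).2.2] at h3

theorem card_arc {i : ZMod n} {l : ℕ} (hl : l ≤ n) : (arc i l).card = l := by
  have h : arc i l = (Finset.range l).image fun d : ℕ => i + 1 + (d : ZMod n) := by
    ext j
    rw [mem_arc, Finset.mem_image]
    obtain ⟨d, hd, rfl⟩ := exists_offset i j
    rw [inArc_add hd]
    constructor
    · intro h
      exact ⟨d, by simpa using h, rfl⟩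
    · rintro ⟨e, he, h⟩
      have he' := Finset.mem_range.mp he
      have := congrArg ZMod.val (add_left_cancel h)
      rw [ZMod.val_natCast_of_lt (by omega), ZMod.val_natCast_of_lt hd] at this
      simp; omega
  rw [h, Finset.card_image_of_injOn, Finset.card_range]
  intro d hd e he h
  have hd' := Finset.mem_range.mp hd
  have he' := Finset.mem_range.mp he
  have := congrArg ZMod.val (add_left_cancel h)
  rwa [ZMod.val_natCast_of_lt (by omega), ZMod.val_natCast_of_lt (by omega)] at this

/-- The number of arcs of length `l` that contain a given node. -/
theorem card_filter_mem_arc {j : ZMod n} {l : ℕ} (hl : l ≤ n) :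
    (Finset.univ.filter fun i : ZMod n => j ∈ arc i l).card = l := by
  conv_rhs => rw [← card_arc (i := -j) hl]
  refine Finset.card_bij' (fun i _ => -i) (fun i _ => -i) ?_ ?_ ?_ ?_
  · intro i hi
    rw [Finset.mem_filter, mem_arc] at hi
    rw [mem_arc]
    have := hi.2
    simp only [inArc] at this ⊢
    convert this using 4
    ring
  · intro i hi
    rw [mem_arc] at hi
    rw [Finset.mem_filter, mem_arc]
    refine ⟨Finset.mem_univ _, ?_⟩
    simp only [inArc] at hi ⊢
    convert hi using 4
    ring
  · intro i _; exact neg_neg i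
  · intro i _; exact neg_neg i

end count

/-! ### Closed forms for the two rings. -/

theorem sum_two_pow_succ (n : ℕ) : ∑ l ∈ Finset.Icc 1 n, 2 ^ (l + 1) + 4 = 2 ^ (n + 2) := by
  induction n with
  | zero => simp
  | succ n ih =>
    rw [Finset.sum_Icc_succ_top (by omega)]
    have : 2 ^ (n + 1 + 2) = 2 * 2 ^ (n + 2) := by ring
    rw [this]
    have : 2 ^ (n + 1 + 1) = 2 ^ (n + 2) := rfl
    omega

theorem ncard_isMinimalConfig_univ {n : ℕ} [NeZero n] :
    ({c | IsMinimalConfig (Finset.univ : Finset (ZMod n)) c}.ncard : ℝ) =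
      4 ^ n + (2 * n + 1 / 2) * 2 ^ n - 3 * n := by
  have hn := NeZero.one_le (n := n)
  rw [ncard_isMinimalConfig _ ⟨0, Finset.mem_univ _⟩]
  have h1 : ∀ i : ZMod n, ∑ l ∈ Finset.Icc 1 (n - 1), 2 ^ (Finset.univ ∩ arc i (l + 1)).card =
      ∑ l ∈ Finset.Icc 1 (n - 1), 2 ^ (l + 1) := by
    intro i
    refine Finset.sum_congr rfl fun l hl => ?_
    rw [Finset.mem_Icc] at hl
    rw [Finset.univ_inter, card_arc (by omega)]
  simp only [h1]
  simp only [Finset.sum_const, Finset.card_univ, ZMod.card, smul_eq_mul]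
  obtain ⟨m, rfl⟩ : ∃ m, n = m + 1 := ⟨n - 1, by omega⟩
  have h2 := sum_two_pow_succ m
  have h3 : ((∑ l ∈ Finset.Icc 1 m, 2 ^ (l + 1) : ℕ) : ℝ) = 2 ^ (m + 2) - 4 := by
    rw [eq_sub_iff_add_eq]
    exact_mod_cast h2
  simp only [Nat.add_sub_cancel]
  rw [Nat.cast_add, Nat.cast_add, Nat.cast_add, Nat.cast_mul, h3]
  push_cast
  have : (4 : ℝ) ^ (m + 1) = 2 ^ (m + 1 + (m + 1)) := by
    rw [pow_add 2, ← mul_pow]; norm_num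
  rw [this]
  ring

theorem sum_mul_two_pow (m : ℕ) (a : ℝ) :
    ∑ l ∈ Finset.Icc 1 m, (a - l) * 2 ^ l = (a - m + 1) * 2 ^ (m + 1) - 2 * a - 2 := by
  induction m with
  | zero => simp; ring
  | succ m ih =>
    rw [Finset.sum_Icc_succ_top (by omega), ih]
    push_cast
    ring

theorem ncard_isMinimalConfig_erase {m : ℕ} (hm : 1 ≤ m) :
    ({c | IsMinimalConfig ((Finset.univ : Finset (ZMod (m + 1))).erase 0) c}.ncard : ℝ) =
      2 * 4 ^ m + (2 * m + 9 / 2) * 2 ^ m - 3 * m - 4 := by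
  have hcard : ((Finset.univ : Finset (ZMod (m + 1))).erase 0).card = m := by
    rw [Finset.card_erase_of_mem (Finset.mem_univ _), Finset.card_univ, ZMod.card]
    rfl
  rw [ncard_isMinimalConfig _ (Finset.card_pos.mp (by omega)), hcard, Finset.sum_comm]
  -- Of the `m + 1` arcs of `l + 1` nodes, `l + 1` contain the column and have `l` blocks; the other
  -- `m - l` have `l + 1` blocks. The coefficient is `(l + 1) + 2 (m - l)`.
  have h1 : ∀ l ∈ Finset.Icc 1 (m + 1 - 1), ((∑ i : ZMod (m + 1),
      2 ^ ((Finset.univ : Finset (ZMod (m + 1))).erase 0 ∩ arc i (l + 1)).card : ℕ) : ℝ) =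
      (((2 * m + 1 : ℕ) : ℝ) - l) * 2 ^ l := by
    intro l hl
    rw [Finset.mem_Icc] at hl
    have h2 : ∀ i : ZMod (m + 1),
        2 ^ ((Finset.univ : Finset (ZMod (m + 1))).erase 0 ∩ arc i (l + 1)).card =
        if (0 : ZMod (m + 1)) ∈ arc i (l + 1) then 2 ^ l else 2 ^ (l + 1) := by
      intro i
      rw [Finset.erase_inter, Finset.univ_inter]
      split_ifs with h
      · rw [Finset.card_erase_of_mem h, card_arc (by omega)]
        rfl
      · rw [Finset.erase_eq_of_notMem h, card_arc (by omega)]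
    simp only [h2]
    rw [Finset.sum_ite, Finset.sum_const, Finset.sum_const,
      card_filter_mem_arc (j := (0 : ZMod (m + 1))) (l := l + 1) (by omega)]
    have h3 := Finset.card_filter_add_card_filter_not (s := Finset.univ)
      (fun i : ZMod (m + 1) => (0 : ZMod (m + 1)) ∈ arc i (l + 1))
    rw [card_filter_mem_arc (j := (0 : ZMod (m + 1))) (l := l + 1) (by omega), Finset.card_univ,
      ZMod.card] at h3
    have h4 : ((Finset.univ.filter fun i : ZMod (m + 1) =>
        ¬ (0 : ZMod (m + 1)) ∈ arc i (l + 1)).card : ℝ) = m - l := by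
      rw [eq_sub_iff_add_eq]
      have : (Finset.univ.filter fun i : ZMod (m + 1) =>
        ¬ (0 : ZMod (m + 1)) ∈ arc i (l + 1)).card + l = m := by omega
      exact_mod_cast this
    simp only [smul_eq_mul]
    push_cast
    rw [h4]
    ring
  rw [Nat.cast_add, Nat.cast_add, Nat.cast_add, Nat.cast_sum, Finset.sum_congr rfl h1,
    Nat.add_sub_cancel, sum_mul_two_pow]
  obtain ⟨p, rfl⟩ : ∃ p, m = p + 1 := ⟨m - 1, by omega⟩
  push_cast
  have : (4 : ℝ) ^ (p + 1) = 2 ^ (p + 1 + (p + 1)) := by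
    rw [pow_add 2, ← mul_pow]; norm_num
  rw [this]
  ring

/-! ### Configurations of the ring as even subgraphs of `MC k`. -/

/-- The selection of the edges `x_z x_{z+1}` of `MC k` that a configuration describes. -/
def railX (k : ℕ) {n : ℕ} (c : RingConfig n) (z : ZMod k) : Bool :=
  if z.val % 2 = 0 then c.1 ((z.val / 2 : ℕ) : ZMod n) else c.2.2 ((z.val / 2 + 1 : ℕ) : ZMod n)

/-- The selection of the edges `y_z y_{z+1}` of `MC k` that a configuration describes. -/
def railY (k : ℕ) {n : ℕ} (c : RingConfig n) (z : ZMod k) : Bool :=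
  if z.val % 2 = 0 then c.2.1 ((z.val / 2 : ℕ) : ZMod n)
  else (c.2.1 ((z.val / 2 : ℕ) : ZMod n) ^^ c.1 ((z.val / 2 + 1 : ℕ) : ZMod n) ^^
    c.2.2 ((z.val / 2 + 1 : ℕ) : ZMod n))

/-- The subgraph of `MC k` that a configuration describes. -/
def configGraph (k : ℕ) {n : ℕ} (c : RingConfig n) : SimpleGraph (ZMod k ⊕ ZMod k) :=
  selectEdges (railX k c) (railY k c) fun z => railX k c z ^^ railX k c (z - 1)

/-- The ring of `n` nodes with blocks `B` is `MC k` with its columns grouped in pairs, one column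
being left over if `k` is odd. -/
structure IsRingOf (k n : ℕ) (B : Finset (ZMod n)) : Prop where
  three_le : 3 ≤ k
  le : k ≤ 2 * n
  lt : 2 * n ≤ k + 1
  mem_iff : ∀ w < n, ((w + 1 : ℕ) : ZMod n) ∈ B ↔ 2 * w + 1 < k

namespace IsRingOf
variable {k n : ℕ} {B : Finset (ZMod n)} (c : RingConfig n)

/-- The block `w + 1` has the columns `2w + 1` and `2w + 2`, so odd rail positions lie inside
blocks; the even position `2w` is the link from node `w` to node `w + 1`. -/
theorem railX_odd {w : ℕ} (hw : 2 * w + 1 < k) :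
    railX k c ((2 * w + 1 : ℕ) : ZMod k) = c.2.2 ((w + 1 : ℕ) : ZMod n) := by
  rw [railX, ZMod.val_natCast_of_lt hw, if_neg (by omega), show (2 * w + 1) / 2 = w by omega]

theorem railY_odd {w : ℕ} (hw : 2 * w + 1 < k) :
    railY k c ((2 * w + 1 : ℕ) : ZMod k) = (c.2.1 (w : ZMod n) ^^ c.1 ((w + 1 : ℕ) : ZMod n) ^^
      c.2.2 ((w + 1 : ℕ) : ZMod n)) := by
  rw [railY, ZMod.val_natCast_of_lt hw, if_neg (by omega), show (2 * w + 1) / 2 = w by omega]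

theorem rungIndex_left {w : ℕ} (hw : 2 * w + 1 < k) :
    rungIndex ((2 * w + 1 : ℕ) : ZMod k) = ((2 * w + 2 : ℕ) : ZMod k) := by
  rw [rungIndex_natCast hw, if_pos (by omega)]

theorem natCast_left (w : ℕ) : ((2 * w + 1 : ℕ) : ZMod k) - 1 = ((2 * w : ℕ) : ZMod k) := by
  push_cast; ring

theorem natCast_right_sub_one (w : ℕ) :
    ((2 * w + 2 : ℕ) : ZMod k) - 1 = ((2 * w + 1 : ℕ) : ZMod k) := by
  push_cast; ring

theorem natCast_pred_succ (hn : n ≠ 0) : ((n - 1 : ℕ) : ZMod n) + 1 = 0 := by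
  rw [Nat.cast_sub (by omega)]; simp

theorem isRingConfig_zero : IsRingConfig B (zeroConfig n) := ⟨fun _ => rfl, fun _ _ => rfl⟩

variable (h : IsRingOf k n B)
include h

theorem ne_zero : n ≠ 0 := by
  have := h.three_le
  have := h.le
  omega

theorem two_mul_lt {w : ℕ} (hw : w < n) : 2 * w < k := by
  have := h.lt
  omega

theorem railX_even {w : ℕ} (hw : w < n) : railX k c ((2 * w : ℕ) : ZMod k) = c.1 (w : ZMod n) := by
  rw [railX, ZMod.val_natCast_of_lt (h.two_mul_lt hw), if_pos (by omega),
    Nat.mul_div_cancel_left _ (by norm_num)]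

theorem railY_even {w : ℕ} (hw : w < n) :
    railY k c ((2 * w : ℕ) : ZMod k) = c.2.1 (w : ZMod n) := by
  rw [railY, ZMod.val_natCast_of_lt (h.two_mul_lt hw), if_pos (by omega),
    Nat.mul_div_cancel_left _ (by norm_num)]

/-- The position `2 w + 2` of `MC k` is the right side of the node `w + 1`. -/
theorem natCast_right {w : ℕ} (hw : 2 * w + 1 < k) :
    ∃ w' < n, ((2 * w + 2 : ℕ) : ZMod k) = ((2 * w' : ℕ) : ZMod k) ∧
      ((w + 1 : ℕ) : ZMod n) = ((w' : ℕ) : ZMod n) := by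
  have := h.le
  rcases Nat.lt_or_ge (w + 1) n with h1 | h1
  · exact ⟨w + 1, h1, rfl, rfl⟩
  · have hn : w + 1 = n := by omega
    have hk : 2 * w + 2 = k := by omega
    refine ⟨0, by omega, ?_, ?_⟩
    · rw [hk]; simp
    · rw [hn]; simp

theorem railX_right {w : ℕ} (hw : 2 * w + 1 < k) :
    railX k c ((2 * w + 2 : ℕ) : ZMod k) = c.1 ((w + 1 : ℕ) : ZMod n) := by
  obtain ⟨w', hw', h1, h2⟩ := h.natCast_right hw
  rw [h1, h2, h.railX_even _ hw']

theorem railY_right {w : ℕ} (hw : 2 * w + 1 < k) :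
    railY k c ((2 * w + 2 : ℕ) : ZMod k) = c.2.1 ((w + 1 : ℕ) : ZMod n) := by
  obtain ⟨w', hw', h1, h2⟩ := h.natCast_right hw
  rw [h1, h2, h.railY_even _ hw']

theorem rungIndex_right {w : ℕ} (hw : 2 * w + 1 < k) :
    rungIndex ((2 * w + 2 : ℕ) : ZMod k) = ((2 * w + 1 : ℕ) : ZMod k) := by
  rw [← rungIndex_left hw, rungIndex_involutive h.three_le]

/-- The left side of the single column. -/
theorem zero_sub_one (hk : k + 1 = 2 * n) : (0 : ZMod k) - 1 = ((2 * (n - 1) : ℕ) : ZMod k) := by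
  have : 2 * (n - 1) = k - 1 := by omega
  have h3 := h.three_le
  rw [this, Nat.cast_sub (by omega)]
  simp

theorem rungIndex_column (hk : k + 1 = 2 * n) : rungIndex (0 : ZMod k) = 0 := by
  have h3 := h.three_le
  have := rungIndex_natCast (k := k) (v := 0) (by omega)
  rw [Nat.cast_zero] at this
  rw [this, if_neg (by omega), if_pos (by omega)]

theorem rail_cases (z : ZMod k) : (∃ w < n, z = ((2 * w : ℕ) : ZMod k)) ∨
    ∃ w, 2 * w + 1 < k ∧ z = ((2 * w + 1 : ℕ) : ZMod k) := by
  have h3 := h.three_le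
  have := h.le
  obtain ⟨v, hv, rfl⟩ := ZMod.exists_natCast_lt (by omega) z
  rcases Nat.even_or_odd' v with ⟨w, rfl | rfl⟩
  · exact Or.inl ⟨w, by omega, rfl⟩
  · exact Or.inr ⟨w, hv, rfl⟩

/-- The residue 0 is the right column of the last block if `k` is even, and the single column if `k`
is odd. -/
theorem rung_cases (z : ZMod k) : (∃ w, 2 * w + 1 < k ∧ z = ((2 * w + 1 : ℕ) : ZMod k)) ∨
    (∃ w, 2 * w + 1 < k ∧ z = ((2 * w + 2 : ℕ) : ZMod k)) ∨ (k + 1 = 2 * n ∧ z = 0) := by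
  have h3 := h.three_le
  have h1 := h.le
  have h2 := h.lt
  rcases h.rail_cases z with ⟨w, hw, rfl⟩ | hz
  · right
    rcases Nat.eq_zero_or_pos w with rfl | hw0
    · rcases Nat.lt_or_ge k (2 * n) with hk | hk
      · exact Or.inr ⟨by omega, by simp⟩
      · refine Or.inl ⟨n - 1, by omega, ?_⟩
        have : 2 * (n - 1) + 2 = k := by omega
        rw [this]; simp
    · have := h.two_mul_lt hw
      refine Or.inl ⟨w - 1, by omega, ?_⟩
      congr 1
      omega
  · exact Or.inl hz

theorem exists_natCast (i : ZMod n) : ∃ w < n, i = (w : ZMod n) ∧ i + 1 = ((w + 1 : ℕ) : ZMod n) := by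
  obtain ⟨w, hw, rfl⟩ := ZMod.exists_natCast_lt h.ne_zero i
  exact ⟨w, hw, rfl, by push_cast; rfl⟩

theorem column_eq {w : ℕ} (hw : w < n) (hB : ((w + 1 : ℕ) : ZMod n) ∉ B) :
    k + 1 = 2 * n ∧ w = n - 1 ∧ ((w + 1 : ℕ) : ZMod n) = ((0 : ℕ) : ZMod n) := by
  rw [h.mem_iff w hw] at hB
  have := h.lt
  have := h.le
  have hwn : w + 1 = n := by omega
  refine ⟨by omega, by omega, ?_⟩
  rw [hwn]; simp

theorem railX_column (hk : k + 1 = 2 * n) :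
    railX k c 0 = c.1 0 ∧ railX k c (0 - 1) = c.1 ((n - 1 : ℕ) : ZMod n) := by
  have hn := h.ne_zero
  refine ⟨?_, ?_⟩
  · have := h.railX_even c (w := 0) (by omega)
    simpa using this
  · rw [h.zero_sub_one hk, h.railX_even c (by omega)]

theorem railY_column (hk : k + 1 = 2 * n) :
    railY k c 0 = c.2.1 0 ∧ railY k c (0 - 1) = c.2.1 ((n - 1 : ℕ) : ZMod n) := by
  have hn := h.ne_zero
  refine ⟨?_, ?_⟩
  · have := h.railY_even c (w := 0) (by omega)
    simpa using this
  · rw [h.zero_sub_one hk, h.railY_even c (by omega)]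

theorem evenDegrees_configGraph {c : RingConfig n} (hc : IsRingConfig B c) :
    EvenDegrees (configGraph k c) := by
  rw [configGraph, evenDegrees_selectEdges_iff _ _ _ h.three_le]
  intro z
  refine ⟨rfl, ?_⟩
  rcases h.rung_cases z with ⟨w, hw, rfl⟩ | ⟨w, hw, rfl⟩ | ⟨hk, rfl⟩
  · have hwn : w < n := by have := h.le; omega
    rw [rungIndex_left hw, natCast_right_sub_one, natCast_left, h.railX_right _ hw,
      railX_odd _ hw, railY_odd _ hw, h.railY_even _ hwn]
    generalize c.1 _ = p, c.2.1 _ = q, c.2.2 _ = r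
    revert p q r
    decide
  · have hwn : w < n := by have := h.le; omega
    rw [h.rungIndex_right hw, natCast_right_sub_one, natCast_left, railX_odd _ hw,
      h.railX_even _ hwn, h.railY_right _ hw, railY_odd _ hw]
    -- At the left `y`-vertex evenness holds by the choice of `railY`; the right one needs the
    -- constant parity of the links.
    have := hc.1 w
    rw [← Nat.cast_succ] at this
    revert this
    generalize c.1 _ = p, c.2.1 _ = q, c.2.2 _ = r, c.1 _ = p', c.2.1 _ = q'
    revert p q r p' q'
    decide
  · rw [h.rungIndex_column hk, (h.railX_column c hk).1, (h.railX_column c hk).2,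
      (h.railY_column c hk).1, (h.railY_column c hk).2]
    have := hc.1 ((n - 1 : ℕ) : ZMod n)
    rw [natCast_pred_succ h.ne_zero] at this
    revert this
    generalize c.1 _ = p, c.2.1 _ = q, c.1 _ = p', c.2.1 _ = q'
    revert p q p' q'
    decide

/-- Links, the four edges of each block and the rung of the column exhaust the edges of `MC k`, and
`RingLe` compares exactly these. -/
theorem configGraph_le_iff (c d : RingConfig n) :
    configGraph k c ≤ configGraph k d ↔ RingLe B c d := by
  rw [configGraph, configGraph, selectEdges_le_iff h.three_le]
  constructor
  · rintro ⟨ha, hb, hc⟩ i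
    obtain ⟨w, hw, hi, hi'⟩ := h.exists_natCast i
    rw [hi', hi]
    refine ⟨?_, ?_, fun hB => ?_, fun hB => ?_⟩
    · rw [← h.railX_even c hw, ← h.railX_even d hw]
      exact ha _
    · rw [← h.railY_even c hw, ← h.railY_even d hw]
      exact hb _
    · rw [h.mem_iff w hw] at hB
      have h1 := ha ((2 * w + 1 : ℕ) : ZMod k)
      have h2 := hc ((2 * w + 1 : ℕ) : ZMod k)
      have h3 := hc ((2 * w + 2 : ℕ) : ZMod k)
      have h4 := hb ((2 * w + 1 : ℕ) : ZMod k)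
      simp only [natCast_left, natCast_right_sub_one, railX_odd _ hB, h.railX_even _ hw,
        h.railX_right _ hB, railY_odd _ hB] at h1 h2 h3 h4
      refine ⟨h1, ?_, h3, h4⟩
      rw [Bool.xor_comm, Bool.xor_comm (d.1 _)]
      exact h2
    · obtain ⟨hk, rfl, h0⟩ := h.column_eq hw hB
      have h1 := hc 0
      simp only [h.railX_column _ hk] at h1
      rw [h0, Nat.cast_zero, ColumnLe, Bool.xor_comm, Bool.xor_comm (d.1 _)]
      exact h1
  · intro hle
    have hle' : ∀ w < n, c.1 (w : ZMod n) ≤ d.1 w ∧ c.2.1 (w : ZMod n) ≤ d.2.1 w :=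
      fun w hw => ⟨(hle w).1, (hle w).2.1⟩
    have hblock : ∀ w, 2 * w + 1 < k → BlockLe (c.1 w) (c.2.1 w) (c.1 ((w + 1 : ℕ) : ZMod n))
        (c.2.2 ((w + 1 : ℕ) : ZMod n)) (d.1 w) (d.2.1 w) (d.1 ((w + 1 : ℕ) : ZMod n))
        (d.2.2 ((w + 1 : ℕ) : ZMod n)) := by
      intro w hw
      have hwn : w < n := by have := h.le; omega
      have h1 := (hle w).2.2.1
      rw [← Nat.cast_succ] at h1
      exact h1 ((h.mem_iff w hwn).mpr hw)
    refine ⟨fun z => ?_, fun z => ?_, fun z => ?_⟩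
    · rcases h.rail_cases z with ⟨w, hw, rfl⟩ | ⟨w, hw, rfl⟩
      · rw [h.railX_even _ hw, h.railX_even _ hw]
        exact (hle' w hw).1
      · rw [railX_odd _ hw, railX_odd _ hw]
        exact (hblock w hw).1
    · rcases h.rail_cases z with ⟨w, hw, rfl⟩ | ⟨w, hw, rfl⟩
      · rw [h.railY_even _ hw, h.railY_even _ hw]
        exact (hle' w hw).2
      · rw [railY_odd _ hw, railY_odd _ hw]
        exact (hblock w hw).2.2.2
    · rcases h.rung_cases z with ⟨w, hw, rfl⟩ | ⟨w, hw, rfl⟩ | ⟨hk, rfl⟩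
      · have hwn : w < n := by have := h.le; omega
        simp only [natCast_left, railX_odd _ hw, h.railX_even _ hwn]
        rw [Bool.xor_comm, Bool.xor_comm (d.2.2 _)]
        exact (hblock w hw).2.1
      · simp only [natCast_right_sub_one, railX_odd _ hw, h.railX_right _ hw]
        exact (hblock w hw).2.2.1
      · simp only [h.railX_column _ hk]
        have hn := h.ne_zero
        have h1 := (hle ((n - 1 : ℕ) : ZMod n)).2.2.2
        have h2 : ((n - 1 : ℕ) : ZMod n) + 1 ∉ B := by
          rw [← Nat.cast_succ, Nat.succ_eq_add_one, h.mem_iff _ (by omega)]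
          omega
        have h1 := h1 h2
        rw [natCast_pred_succ hn, ColumnLe, Bool.xor_comm, Bool.xor_comm (d.1 _)] at h1
        exact h1

theorem injOn_configGraph : Set.InjOn (configGraph k) {c | IsRingConfig B c} := by
  intro c hc d hd hcd
  have h1 := (h.configGraph_le_iff c d).mp hcd.le
  have h2 := (h.configGraph_le_iff d c).mp hcd.ge
  refine config_ext (fun i => le_antisymm (h1 i).1 (h2 i).1)
    (fun i => le_antisymm (h1 i).2.1 (h2 i).2.1) fun i => ?_
  by_cases hi : i + 1 ∈ B
  · exact le_antisymm ((h1 i).2.2.1 hi).1 ((h2 i).2.2.1 hi).1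
  · rw [hc.2 _ hi, hd.2 _ hi]

theorem exists_configGraph_eq {H : SimpleGraph (ZMod k ⊕ ZMod k)} (hH : H ≤ MC k)
    (he : EvenDegrees H) : ∃ c : RingConfig n, IsRingConfig B c ∧ configGraph k c = H := by
  classical
  obtain ⟨a, b, r, rfl⟩ := exists_selectEdges_of_le_MC h.three_le hH
  rw [evenDegrees_selectEdges_iff _ _ _ h.three_le] at he
  have hr : r = fun z => a z ^^ a (z - 1) := funext fun z => (he z).1
  have hab : ∀ z, (a (rungIndex z) ^^ a (rungIndex z - 1)) = (b z ^^ b (z - 1)) := by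
    intro z
    rw [← (he z).2, (he (rungIndex z)).1]
  -- The bit of node `i` is read at position `2i - 1`, between the two columns of its block, also
  -- for node 0, where the subtraction wraps around.
  let c : RingConfig n := (fun i => a ((2 * i.val : ℕ) : ZMod k),
    fun i => b ((2 * i.val : ℕ) : ZMod k),
    fun i => decide (i ∈ B) && a (((2 * i.val : ℕ) : ZMod k) - 1))
  have hc1 : ∀ w < n, c.1 (w : ZMod n) = a ((2 * w : ℕ) : ZMod k) := by
    intro w hw
    simp only [c]
    rw [ZMod.val_natCast_of_lt hw]
  have hc2 : ∀ w < n, c.2.1 (w : ZMod n) = b ((2 * w : ℕ) : ZMod k) := by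
    intro w hw
    simp only [c]
    rw [ZMod.val_natCast_of_lt hw]
  have hright : ∀ w, 2 * w + 1 < k →
      c.1 ((w + 1 : ℕ) : ZMod n) = a ((2 * w + 2 : ℕ) : ZMod k) ∧
      c.2.1 ((w + 1 : ℕ) : ZMod n) = b ((2 * w + 2 : ℕ) : ZMod k) ∧
      c.2.2 ((w + 1 : ℕ) : ZMod n) = a ((2 * w + 1 : ℕ) : ZMod k) := by
    intro w hw
    have hwn : w < n := by have := h.le; omega
    have hB := (h.mem_iff w hwn).mpr hw
    obtain ⟨w', hw', h1, h2⟩ := h.natCast_right hw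
    rw [← natCast_right_sub_one w, h1]
    rw [h2] at hB ⊢
    refine ⟨hc1 w' hw', hc2 w' hw', ?_⟩
    simp only [c]
    rw [ZMod.val_natCast_of_lt hw', decide_eq_true hB, Bool.true_and]
  have hrung : ∀ w, 2 * w + 1 < k →
      (a ((2 * w + 2 : ℕ) : ZMod k) ^^ a ((2 * w + 1 : ℕ) : ZMod k)) =
        (b ((2 * w + 1 : ℕ) : ZMod k) ^^ b ((2 * w : ℕ) : ZMod k)) ∧
      (a ((2 * w + 1 : ℕ) : ZMod k) ^^ a ((2 * w : ℕ) : ZMod k)) =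
        (b ((2 * w + 2 : ℕ) : ZMod k) ^^ b ((2 * w + 1 : ℕ) : ZMod k)) := by
    intro w hw
    have h1 := hab ((2 * w + 1 : ℕ) : ZMod k)
    have h2 := hab ((2 * w + 2 : ℕ) : ZMod k)
    rw [rungIndex_left hw, natCast_right_sub_one, natCast_left] at h1
    rw [h.rungIndex_right hw, natCast_right_sub_one, natCast_left] at h2
    exact ⟨h1, h2⟩
  refine ⟨c, ⟨fun i => ?_, fun i hi => by simp [c, hi]⟩, ?_⟩
  · obtain ⟨w, hw, hi, hi'⟩ := h.exists_natCast i
    rw [hi', hi, hc1 w hw, hc2 w hw]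
    by_cases hB : ((w + 1 : ℕ) : ZMod n) ∈ B
    · rw [h.mem_iff w hw] at hB
      obtain ⟨h1, h2⟩ := hrung w hB
      rw [(hright w hB).1, (hright w hB).2.1]
      revert h1 h2
      generalize a _ = p, a _ = p', b _ = q, b _ = q', a _ = p'', b _ = q''
      revert p p' q q' p'' q''
      decide
    · obtain ⟨hk, rfl, h0⟩ := h.column_eq hw hB
      have h1 := hab 0
      rw [h.rungIndex_column hk, h.zero_sub_one hk] at h1
      rw [h0, hc1 0 (by omega), hc2 0 (by omega)]
      simp only [Nat.mul_zero, Nat.cast_zero]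
      revert h1
      generalize a _ = p, a _ = p', b _ = q, b _ = q'
      revert p p' q q'
      decide
  · have hX : railX k c = a := by
      funext z
      rcases h.rail_cases z with ⟨w, hw, rfl⟩ | ⟨w, hw, rfl⟩
      · rw [h.railX_even c hw, hc1 w hw]
      · rw [railX_odd c hw, (hright w hw).2.2]
    have hY : railY k c = b := by
      funext z
      rcases h.rail_cases z with ⟨w, hw, rfl⟩ | ⟨w, hw, rfl⟩
      · rw [h.railY_even c hw, hc2 w hw]
      · have hwn : w < n := by have := h.le; omega
        rw [railY_odd c hw, (hright w hw).2.2, (hright w hw).1, hc2 w hwn]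
        have h1 := (hrung w hw).1
        revert h1
        generalize a _ = p, a _ = p', b _ = q, b _ = q'
        revert p p' q q'
        decide
    rw [configGraph, hX, hY, hr]

theorem configGraph_le_MC (c : RingConfig n) : configGraph k c ≤ MC k := by
  rw [selectEdges_top_eq_MC h.three_le, configGraph, selectEdges_le_iff h.three_le]
  exact ⟨fun _ => Bool.le_true _, fun _ => Bool.le_true _, fun _ => Bool.le_true _⟩

theorem configGraph_zero : configGraph k (zeroConfig n) = ⊥ := by
  have h3 := h.three_le
  ext u v
  have hX : railX k (zeroConfig n) = fun _ => false := by
    funext z; simp [railX, zeroConfig]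
  have hY : railY k (zeroConfig n) = fun _ => false := by
    funext z; simp [railY, zeroConfig]
  rw [configGraph, hX, hY]
  rcases u with i | i <;> rcases v with j | j
  · simp [selectEdges_inl_inl _ _ _ h3]
  · simp [selectEdges_inl_inr]
  · simp [selectEdges_inr_inl]
  · simp [selectEdges_inr_inr _ _ _ h3]

theorem configGraph_ne_bot_iff {c : RingConfig n} (hc : IsRingConfig B c) :
    configGraph k c ≠ ⊥ ↔ c ≠ zeroConfig n := by
  rw [← h.configGraph_zero, ne_eq, h.injOn_configGraph.eq_iff hc isRingConfig_zero]

/-- `configGraph` is an order isomorphism onto the even subgraphs of `MC k` and takes the zero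
configuration to `⊥`, so minimal nonzero elements correspond. -/
theorem cycleCount_MC_eq : cycleCount (MC k) = {c | IsMinimalConfig B c}.ncard := by
  have hk : NeZero k := ⟨by have := h.three_le; omega⟩
  have hinj : Set.InjOn (configGraph k) {c | IsMinimalConfig B c} :=
    h.injOn_configGraph.mono fun c hc => hc.1
  rw [cycleCount_eq_ncard_minimal, ← hinj.ncard_image]
  congr 1
  ext H
  constructor
  · rintro ⟨hle, hH⟩
    obtain ⟨c, hc, rfl⟩ := h.exists_configGraph_eq hle hH.1.2
    refine ⟨c, ⟨hc, (h.configGraph_ne_bot_iff hc).mp hH.1.1, fun d hd hd0 hdc => ?_⟩, rfl⟩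
    have := hH.eq_of_le (y := configGraph k d)
      ⟨(h.configGraph_ne_bot_iff hd).mpr hd0, h.evenDegrees_configGraph hd⟩
      ((h.configGraph_le_iff d c).mpr hdc)
    exact h.injOn_configGraph hd hc (by rw [this])
  · rintro ⟨c, hc, rfl⟩
    refine ⟨h.configGraph_le_MC c, ⟨(h.configGraph_ne_bot_iff hc.1).mpr hc.2.1,
      h.evenDegrees_configGraph hc.1⟩, fun K hK hKc => ?_⟩
    obtain ⟨d, hd, rfl⟩ := h.exists_configGraph_eq (hKc.trans (h.configGraph_le_MC c)) hK.2
    have := hc.2.2 d hd ((h.configGraph_ne_bot_iff hd).mp hK.1) ((h.configGraph_le_iff d c).mp hKc)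
    rw [this]

end IsRingOf

theorem isRingOf_two_mul {n : ℕ} [NeZero n] (hn : 2 ≤ n) :
    IsRingOf (2 * n) n (Finset.univ : Finset (ZMod n)) where
  three_le := by omega
  le := le_rfl
  lt := by omega
  mem_iff w hw := by simp; omega

theorem isRingOf_two_mul_add_one {m : ℕ} (hm : 1 ≤ m) :
    IsRingOf (2 * m + 1) (m + 1) ((Finset.univ : Finset (ZMod (m + 1))).erase 0) where
  three_le := by omega
  le := by omega
  lt := by omega
  mem_iff w hw := by
    rw [Finset.mem_erase, and_iff_left (Finset.mem_univ _), ne_eq, ZMod.natCast_eq_zero_iff]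
    constructor
    · intro h
      by_contra hlt
      have : w = m := by omega
      exact h (this ▸ dvd_rfl)
    · intro h hd
      have := Nat.le_of_dvd (by omega) hd
      omega

/-! ### Cycle counts of `MC k` and bounds for `Psi`. -/

theorem cycleCount_MC_of_even {k : ℕ} (hk : 3 ≤ k) (he : Even k) : (cycleCount (MC k) : ℝ) =
    2 ^ k + ((k : ℝ) + 1 / 2) * 2 ^ (k / 2) - 3 / 2 * (k : ℝ) := by
  obtain ⟨n, rfl⟩ := he.two_dvd
  have : NeZero n := ⟨by omega⟩
  rw [(isRingOf_two_mul (by omega)).cycleCount_MC_eq, ncard_isMinimalConfig_univ,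
    Nat.mul_div_cancel_left _ (by norm_num), pow_mul]
  push_cast
  ring

theorem cycleCount_MC_of_odd {k : ℕ} (hk : 3 ≤ k) (ho : Odd k) : (cycleCount (MC k) : ℝ) =
    2 ^ k + ((k : ℝ) + 7 / 2) * 2 ^ ((k - 1) / 2) - 1 / 2 * (3 * (k : ℝ) + 5) := by
  obtain ⟨m, rfl⟩ := ho
  rw [(isRingOf_two_mul_add_one (by omega)).cycleCount_MC_eq,
    ncard_isMinimalConfig_erase (by omega), Nat.add_sub_cancel,
    Nat.mul_div_cancel_left _ (by norm_num), pow_succ, pow_mul]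
  push_cast
  ring

theorem cycleCount_MC_mem {r : ℕ} (hr : 4 ≤ r) : cycleCount (MC (r - 1)) ∈ cycleCounts r := by
  have : NeZero (r - 1) := ⟨by omega⟩
  refine ⟨ZMod (r - 1) ⊕ ZMod (r - 1), inferInstance, MC (r - 1), connected_MC (by omega), ?_, rfl⟩
  rw [cyclomaticNumber_MC (by omega)]
  omega

theorem cycleCount_MC_le_Psi {r : ℕ} (hr : 4 ≤ r) : (cycleCount (MC (r - 1)) : ℝ) ≤ Psi r := by
  exact_mod_cast (isGreatest_Psi ⟨_, cycleCount_MC_mem hr⟩).2 (cycleCount_MC_mem hr)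

theorem Psi_ge_of_odd {r : ℕ} (hr : 4 ≤ r) (ho : Odd r) : (Psi r : ℝ) ≥
    2 ^ (r - 1) + ((r : ℝ) - 1 / 2) * 2 ^ ((r - 1) / 2) - 3 / 2 * ((r : ℝ) - 1) := by
  refine le_trans (le_of_eq ?_) (cycleCount_MC_le_Psi hr)
  rw [cycleCount_MC_of_even (by omega) (Nat.Odd.sub_odd ho odd_one), Nat.cast_sub (by omega)]
  push_cast
  ring

theorem Psi_ge_of_even {r : ℕ} (hr : 4 ≤ r) (he : Even r) : (Psi r : ℝ) ≥
    2 ^ (r - 1) + ((r : ℝ) + 5 / 2) * 2 ^ ((r - 2) / 2) - 1 / 2 * (3 * (r : ℝ) + 2) := by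
  refine le_trans (le_of_eq ?_) (cycleCount_MC_le_Psi hr)
  rw [cycleCount_MC_of_odd (by omega) (Nat.Even.sub_odd (by omega) he odd_one),
    Nat.cast_sub (by omega), Nat.sub_sub]
  push_cast
  ring

/-- The second term is about `r * Q / 2` or more, where `Q = 2 ^ (r / 2)`. Half of it gives the
constant `1 / 4`; the other half absorbs the negative linear term, as `Q ≥ 8` for `r ≥ 6`. -/
theorem Psi_ge_asymptotic {r : ℕ} (hr : 6 ≤ r) :
    (Psi r : ℝ) ≥ 2 ^ (r - 1) + 1 / 4 * (r : ℝ) * (2 : ℝ) ^ ((r : ℝ) / 2) := by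
  have hr' : (6 : ℝ) ≤ r := by exact_mod_cast hr
  set Q : ℝ := (2 : ℝ) ^ ((r : ℝ) / 2) with hQ
  have h8 : (8 : ℝ) ≤ Q := by
    calc (8 : ℝ) = (2 : ℝ) ^ ((3 : ℕ) : ℝ) := by rw [Real.rpow_natCast]; norm_num
      _ ≤ Q := Real.rpow_le_rpow_of_exponent_le (by norm_num) (by push_cast; linarith)
  -- Covers both parities: `m = (r - 2) / 2` is exact for even `r`, and `m = (r - 1) / 2` has a
  -- factor `√2` to spare for odd `r`.
  have key : ∀ m : ℕ, r ≤ 2 * m + 2 → Q / 2 ≤ 2 ^ m := by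
    intro m hm
    have hm' : (r : ℝ) ≤ 2 * m + 2 := by exact_mod_cast hm
    have : Q ≤ (2 : ℝ) ^ ((m + 1 : ℕ) : ℝ) :=
      Real.rpow_le_rpow_of_exponent_le (by norm_num) (by push_cast; linarith)
    rw [Real.rpow_natCast, pow_succ] at this
    linarith
  rcases Nat.even_or_odd r with he | ho
  · refine le_trans ?_ (Psi_ge_of_even (by omega) he)
    have h1 := key ((r - 2) / 2) (by obtain ⟨m, rfl⟩ := he; omega)
    nlinarith [mul_le_mul_of_nonneg_left h1 (by linarith : (0 : ℝ) ≤ (r : ℝ) + 5 / 2),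
      mul_le_mul_of_nonneg_left h8 (by linarith : (0 : ℝ) ≤ (r : ℝ))]
  · refine le_trans ?_ (Psi_ge_of_odd (by omega) ho)
    have h1 := key ((r - 1) / 2) (by obtain ⟨m, rfl⟩ := ho; omega)
    nlinarith [mul_le_mul_of_nonneg_left h1 (by linarith : (0 : ℝ) ≤ (r : ℝ) - 1 / 2),
      mul_le_mul_of_nonneg_left h8 (by linarith : (0 : ℝ) ≤ (r : ℝ) - 1)]

theorem mainTheorem5 :
    -- `MC_k` is connected, has cyclomatic number `k + 1`, and has the stated number of cycles
    (∀ k : ℕ, 3 ≤ k →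
      (MC k).Connected ∧
      cyclomaticNumber (MC k) = (k : ℤ) + 1 ∧
      (Even k → (cycleCount (MC k) : ℝ) =
        2 ^ k + ((k : ℝ) + 1 / 2) * 2 ^ (k / 2) - 3 / 2 * (k : ℝ)) ∧
      (Odd k → (cycleCount (MC k) : ℝ) =
        2 ^ k + ((k : ℝ) + 7 / 2) * 2 ^ ((k - 1) / 2) - 1 / 2 * (3 * (k : ℝ) + 5))) ∧
    -- explicit lower bounds on `Ψ(r)`, which is a genuine maximum
    (∀ r : ℕ, 4 ≤ r →
      IsGreatest (cycleCounts r) (Psi r) ∧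
      (Odd r → (Psi r : ℝ) ≥
        2 ^ (r - 1) + ((r : ℝ) - 1 / 2) * 2 ^ ((r - 1) / 2) - 3 / 2 * ((r : ℝ) - 1)) ∧
      (Even r → (Psi r : ℝ) ≥
        2 ^ (r - 1) + ((r : ℝ) + 5 / 2) * 2 ^ ((r - 2) / 2) - 1 / 2 * (3 * (r : ℝ) + 2))) ∧
    -- the asymptotic lower bound
    (∃ c : ℝ, 0 < c ∧ ∀ᶠ r : ℕ in atTop,
      (Psi r : ℝ) ≥ 2 ^ (r - 1) + c * (r : ℝ) * (2 : ℝ) ^ ((r : ℝ) / 2)) := by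
  refine ⟨fun k hk => ⟨connected_MC hk, cyclomaticNumber_MC hk, cycleCount_MC_of_even hk,
    cycleCount_MC_of_odd hk⟩, fun r hr => ⟨isGreatest_Psi ⟨_, cycleCount_MC_mem hr⟩,
    Psi_ge_of_odd hr, Psi_ge_of_even hr⟩, 1 / 4, by norm_num, ?_⟩
  filter_upwards [eventually_ge_atTop 6] with r hr
  exact Psi_ge_asymptotic hr
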